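/- \textbf{Theorem (Generalisation of Primc's identity).} Let $n$ be a positive integer, let $(a_i)_{0\le i\le n-1}$ and $(b_i)_{0\le i\le n-1}$ be symbols, and for $i,k,i',k'\in\{0,\dots,n-1\}$ set $$\Delta(a_ib_k,a_{i'}b_{k'})=\chi(i\ge i')-\chi(i=k=i')+\chi(k\le k')-\chi(k=i'=k'),$$ where $\chi(\text{prop})$ is $1$ if the proposition is true and $0$ otherwise. A \emph{generalised Primc partition} of $m$ is a finite (possibly empty) sequence $(\lambda_1,\dots,\lambda_s)$ of positive integers with sum $m$, each part $\lambda_j$ having a colour $c(\lambda_j)\in\{a_ib_k: 0\le i,k\le n-1\}$, such that $\lambda_j-\lambda_{j+1}\ge\Delta(c(\lambda_j),c(\lambda_{j+1}))$ for $1\le j\le s-1$. Let $P_n(m;u_0,\dots,u_{n-1};v_0,\dots,v_{n-1})$ be the number of those in which, for every $i$, the symbol $a_i$ appears $u_i$ times and the symbol $b_i$ appears $v_i$ times in the colours of the parts. An \emph{$n^2$-coloured Frobenius partition} of $m$ is a two-rowed array $\begin{pmatrix}\lambda_1&\cdots&\lambda_s\\ \mu_1&\cdots&\mu_s\end{pmatrix}$,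 $s\ge 0$, with $m=s+\sum_j\lambda_j+\sum_j\mu_j$, where the $\lambda_j$ are non-negative integers each coloured with some $a_i$, strictly decreasing for the order $0_{a_{n-1}}<\cdots<0_{a_0}<1_{a_{n-1}}<\cdots<1_{a_0}<\cdots$, and the $\mu_j$ are non-negative integers each coloured with some $b_i$, strictly decreasing for the order $0_{b_0}<\cdots<0_{b_{n-1}}<1_{b_0}<\cdots<1_{b_{n-1}}<\cdots$ $(0\le i\le n-1)$. Let $F_n(m;u_0,\dots,u_{n-1};v_0,\dots,v_{n-1})$ be the number of those in which, for every $i$, the symbol $a_i$ appears $u_i$ times and the symbol $b_i$ appears $v_i$ times. Then for every $m$ there are finitely many generalised Primc partitions of $m$ and finitely many $n^2$-coloured Frobenius partitions of $m$, and, as formal power series in $q$ over $\mathbb Z[a_0^{\pm1},\dots,a_{n-1}^{\pm1}]$, \begin{align*} &\sum_{m,u_0,\dots,u_{n-1},v_0,\dots,v_{n-1}\ge0}P_n(m;u_0,\dots,u_{n-1};v_0,\dots,v_{n-1})\,q^m a_0^{u_0-v_0}\cdots a_{n-1}^{u_{n-1}-v_{n-1}}\\ &=\sum_{m,u_0,\dots,u_{n-1},v_0,\dots,v_{n-1}\ge0}F_n(m;u_0,\dots,u_{n-1};v_0,\dots,v_{n-1})\,q^m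 a_0^{u_0-v_0}\cdots a_{n-1}^{u_{n-1}-v_{n-1}}\\ &=[x^0]\prod_{i=0}^{n-1}(-xa_iq;q)_\infty(-x^{-1}a_i^{-1};q)_\infty, \end{align*} where $(z;q)_\infty=\prod_{k\ge0}(1-zq^k)$ and $[x^0]$ denotes the constant term in $x$. -/

import Mathlib

namespace PrimcFrobenius

/-! ### Generalised Primc partitions -/

/-- The colour `a_i b_k`, encoded as the pair `(i, k)`. -/
abbrev Colour (n : ℕ) := Fin n × Fin n

/-- The minimal difference `Δ(a_i b_k, a_{i'} b_{k'})
= χ(i ≥ i') - χ(i = k = i') + χ(k ≤ k') - χ(k = i' = k')`, computed in `ℤ`. -/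
def minDiff {n : ℕ} (c d : Colour n) : ℤ :=
  (if c.1 ≥ d.1 then 1 else 0) - (if c.1 = c.2 ∧ c.2 = d.1 then 1 else 0)
    + (if c.2 ≤ d.2 then 1 else 0) - (if c.2 = d.1 ∧ d.1 = d.2 then 1 else 0)

/-- A generalised Primc partition `λ₁ + ⋯ + λ_s`: the list of its coloured parts
`(size, colour)`, with positive sizes, in the order `λ₁, …, λ_s`, such that
`λ_j - λ_{j+1} ≥ Δ(c(λ_j), c(λ_{j+1}))` for consecutive parts. -/
def IsPrimc {n : ℕ} (l : List (ℕ × Colour n)) : Prop :=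
  (∀ p ∈ l, 0 < p.1) ∧
    l.IsChain (fun p p' => minDiff p.2 p'.2 ≤ (p.1 : ℤ) - (p'.1 : ℤ))

/-- The sum of the sizes of the parts of a list of coloured parts. -/
def size {γ : Type*} (l : List (ℕ × γ)) : ℕ := (l.map Prod.fst).sum

/-- The generalised Primc partitions of `m`. -/
def primcPartitions (n m : ℕ) : Set (List (ℕ × Colour n)) :=
  {l | IsPrimc l ∧ size l = m}

/-- The number `P_n(m; u; v)` of generalised Primc partitions of `m` in which, for every `i`,
the symbol `a_i` appears `u i` times and the symbol `b_i` appears `v i` times. -/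
noncomputable def primcCount (n m : ℕ) (u v : Fin n → ℕ) : ℕ :=
  {l ∈ primcPartitions n m | ∀ i, l.countP (fun p => p.2.1 = i) = u i ∧
    l.countP (fun p => p.2.2 = i) = v i}.ncard

/-! ### Coloured Frobenius partitions -/

/-- `k_{a_i} > k'_{a_{i'}}` in the order
`0_{a_{n-1}} < ⋯ < 0_{a_0} < 1_{a_{n-1}} < ⋯ < 1_{a_0} < ⋯`. -/
def gtA {n : ℕ} (p p' : ℕ × Fin n) : Prop := p'.1 < p.1 ∨ (p'.1 = p.1 ∧ p.2 < p'.2)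

/-- `k_{b_i} > k'_{b_{i'}}` in the order
`0_{b_0} < ⋯ < 0_{b_{n-1}} < 1_{b_0} < ⋯ < 1_{b_{n-1}} < ⋯`. -/
def gtB {n : ℕ} (p p' : ℕ × Fin n) : Prop := p'.1 < p.1 ∨ (p'.1 = p.1 ∧ p'.2 < p.2)

/-- An `n²`-coloured Frobenius partition: two rows `λ`, `μ` of the same length, of non-negative
parts coloured by the `a_i` in `λ` and by the `b_i` in `μ`, each row consisting of distinct
coloured parts written in decreasing order. -/
def IsFrobenius {n : ℕ} (r : List (ℕ × Fin n) × List (ℕ × Fin n)) : Prop :=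
  r.1.length = r.2.length ∧ r.1.Pairwise gtA ∧ r.2.Pairwise gtB

/-- The `n²`-coloured Frobenius partitions of weight `m = s + ∑ λ_i + ∑ μ_i`. -/
def frobeniusPartitions (n m : ℕ) : Set (List (ℕ × Fin n) × List (ℕ × Fin n)) :=
  {r | IsFrobenius r ∧ r.1.length + size r.1 + size r.2 = m}

/-- The number `F_n(m; u; v)` of `n²`-coloured Frobenius partitions of `m` in which, for every `i`,
the symbol `a_i` appears `u i` times and the symbol `b_i` appears `v i` times. -/
noncomputable def frobeniusCount (n m : ℕ) (u v : Fin n → ℕ) : ℕ :=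
  {r ∈ frobeniusPartitions n m | ∀ i, r.1.countP (fun p => p.2 = i) = u i ∧
    r.2.countP (fun p => p.2 = i) = v i}.ncard

/-! ### Generating functions -/

/-- The ring `ℤ[a_0^{±1}, …, a_{n-1}^{±1}]` of Laurent polynomials. -/
abbrev ColourRing (n : ℕ) := AddMonoidAlgebra ℤ (Fin n → ℤ)

/-- The monomial `a_0^{e_0} ⋯ a_{n-1}^{e_{n-1}}`. -/
noncomputable def aMonomial {n : ℕ} (e : Fin n → ℤ) : ColourRing n :=
  AddMonoidAlgebra.single e 1

/-- The formal power series
`∑_{m, u, v ≥ 0} N(m; u; v) q^m a_0^{u_0 - v_0} ⋯ a_{n-1}^{u_{n-1} - v_{n-1}}` in `q` over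
`ℤ[a_i^{±1}]`, where for each `m` only finitely many `N(m; u; v)` are non-zero. -/
noncomputable def genFun {n : ℕ} (N : ℕ → (Fin n → ℕ) → (Fin n → ℕ) → ℕ) :
    PowerSeries (ColourRing n) :=
  PowerSeries.mk fun m => ∑ᶠ uv : (Fin n → ℕ) × (Fin n → ℕ),
    N m uv.1 uv.2 • aMonomial (fun i => (uv.1 i : ℤ) - (uv.2 i : ℤ))

/-! ### The infinite product and its constant term -/

section Pochhammer

open scoped PowerSeries.WithPiTopology

/-- `(z; q)_∞ = ∏_{k ≥ 0} (1 - z q^k)`, as an infinite product of formal power series in `q`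
(the variable `PowerSeries.X`) converging coefficientwise, i.e. in the product topology for the
discrete topology on coefficients. -/
noncomputable def qPochhammerInf {R : Type*} [CommRing R] (z : PowerSeries R) : PowerSeries R :=
  letI : TopologicalSpace R := ⊥
  ∏' k : ℕ, (1 - z * PowerSeries.X ^ k)

/-- The infinite product defining `(z; q)_∞` always converges. -/
theorem multipliable_qPochhammerInf {R : Type*} [CommRing R] (z : PowerSeries R) :
    letI : TopologicalSpace R := ⊥
    Multipliable fun k : ℕ => (1 - z * PowerSeries.X ^ k) := by
  letI : TopologicalSpace R := ⊥
  have h : Multipliable fun k : ℕ => (1 + -(z * PowerSeries.X ^ k)) := by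
    apply PowerSeries.WithPiTopology.multipliable_one_add_of_tendsto_order_atTop_nhds_top
    rw [ENat.tendsto_nhds_top_iff_natCast_lt]
    intro m
    filter_upwards [Filter.eventually_gt_atTop m] with k hk
    refine lt_of_lt_of_le (Nat.cast_lt.mpr hk) ?_
    rw [PowerSeries.order_neg]
    refine PowerSeries.le_order _ _ fun i hi => ?_
    rw [PowerSeries.coeff_mul_X_pow', if_neg (by exact_mod_cast not_le.mpr hi)]
  simpa only [sub_eq_add_neg] using h

end Pochhammer

/-- The monomial `x^j a_0^{e_0} ⋯ a_{n-1}^{e_{n-1}}`, as a constant power series in `q` over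
`ℤ[a_i^{±1}][x^{±1}]`. -/
noncomputable def xaMonomial {n : ℕ} (j : ℤ) (e : Fin n → ℤ) :
    PowerSeries (LaurentPolynomial (ColourRing n)) :=
  PowerSeries.C (LaurentPolynomial.C (aMonomial e) * LaurentPolynomial.T j)

/-- The product `∏_{i=0}^{n-1} (-x a_i q; q)_∞ (-x⁻¹ a_i⁻¹; q)_∞`. -/
noncomputable def frobeniusProduct (n : ℕ) : PowerSeries (LaurentPolynomial (ColourRing n)) :=
  ∏ i : Fin n, qPochhammerInf (-(xaMonomial 1 (Pi.single i 1) * PowerSeries.X)) *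
    qPochhammerInf (-xaMonomial (-1) (-Pi.single i 1))

/-- The constant term `[x^0] G`, taken in each coefficient of the power series `G` in `q`. -/
noncomputable def constTermX {A : Type*} [CommRing A] (G : PowerSeries (LaurentPolynomial A)) :
    PowerSeries A :=
  PowerSeries.mk fun m => (PowerSeries.coeff m G).coeff 0

end PrimcFrobenius

/-! Both partition generating functions are the value at N = 1, p = n, m = 0 of a grid R N p m
solving one linear system of q-difference equations, `IsGrid`, which has only one solution tending
to 1 as N grows.

Primc side. Let G N i k count the partitions whose smallest part is at least N and has colour a_i
b_k. Removing a smallest part equal to N leaves partitions with thresholds N + Δ. Up to corrections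
these thresholds have the form N + χ(p ≤ i') + χ(k' < m), so the sums of the G are entries of a
grid, `primcGrid`. The remaining correction concerns only the colour a_i b_i, whose contribution is
again a multiple of a grid entry because a_i b_i = 1. The mixed second difference of the grid in p
and m isolates a single colour, and this closes the system (`IsPrimcSystem.isGrid`).

Frobenius side. Let U_r(p), V_r(m) count rows of length r bounded below by 0_{a_p}, 0_{b_m}. The
mixed difference of U_{r+1} V_{r+1} is a_i b_k U_r V_r, so suitable series ∑ c_r U_r V_r, with c_r
rational in q^N and q, solve the same system; the check reduces to identities between the c_r
(`IsRowPair.isGrid`). At (1, n, 0) the solution collapses to ∑ q^r U_r(n) V_r(0), which counts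
Frobenius partitions by their number r of columns (`frobeniusGf_eq_tsum`).

Uniqueness (`IsGrid.eq_zero`). The right side of the system carries a factor q, so the difference of
two solutions is divisible by every power of q.

Constant term. The product expands into pairs of rows of arbitrary lengths, x recording the
difference of the lengths; the q in -x a_i q adds 1 to each part of the first row and so supplies
the summand s of the weight. -/

namespace PrimcFrobenius

/-! ### Uniqueness for the system of q-difference equations -/

section Algebra

open PowerSeries

variable {A : Type*} [CommRing A]

/-- The inverse of `1 - X ^ N` for `0 < N`. -/
noncomputable def geom (A : Type*) [CommRing A] (N : ℕ) : A⟦X⟧ := invOfUnit (1 - X ^ N) 1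

theorem one_sub_X_pow_mul_geom {N : ℕ} (hN : 1 ≤ N) : (1 - X ^ N) * geom A N = 1 := by
  apply mul_invOfUnit
  have : N ≠ 0 := by omega
  simp [this]

/-- A sequence whose increments are divisible by `X ^ t` and which tends to `0` is divisible
by `X ^ t`. -/
theorem X_pow_dvd_of_X_pow_dvd_sub {t : ℕ} {f : ℕ → A⟦X⟧}
    (h : ∀ N, 1 ≤ N → X ^ t ∣ f N - f (N + 1)) (h0 : ∀ N, 1 ≤ N → X ^ N ∣ f N)
    {N : ℕ} (hN : 1 ≤ N) : X ^ t ∣ f N := by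
  have key : ∀ j, X ^ t ∣ f N - f (N + j) := by
    intro j
    induction j with
    | zero => simp
    | succ j ih =>
      have := dvd_add ih (h (N + j) (by omega))
      simpa [add_assoc] using this
  have h1 : X ^ t ∣ f (N + t) := (pow_dvd_pow X (by omega)).trans (h0 (N + t) (by omega))
  simpa using dvd_add (key t) h1

/-- The mixed differences over unit squares telescope to the mixed difference over the whole
rectangle. -/
theorem dvd_rectangle {B : Type*} [CommRing B] {n : ℕ} {d : B} {e : ℕ → ℕ → B}
    (h : ∀ i k, i < n → k < n → d ∣ e (i + 1) k - e i k - e (i + 1) (k + 1) + e i (k + 1))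
    {p m : ℕ} (hp : p ≤ n) (hm : m ≤ n) : d ∣ e p m - e p 0 - e 0 m + e 0 0 := by
  have h1 : ∀ i, i < n → ∀ m, m ≤ n → d ∣ e (i + 1) 0 - e i 0 - e (i + 1) m + e i m := by
    intro i hi m hm
    induction m with
    | zero => simp
    | succ m ih =>
      have := dvd_add (ih (by omega)) (h i m hi (by omega))
      convert this using 1
      ring
  induction p with
  | zero => simp
  | succ p ih =>
    have := dvd_sub (ih (by omega)) (h1 p (by omega) m hm)
    convert this using 1
    ring

/-- The contribution of a smallest part equal to `N` of colour `a_i b_k`, in terms of the grid `R`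
of generating functions. -/
noncomputable def gridStep (a b : ℕ → A) (R : ℕ → ℕ → ℕ → A⟦X⟧) (i k N : ℕ) : A⟦X⟧ :=
  if k < i then X ^ N * (C (a i * b k) * (R N i (k + 1) + X ^ N * (geom A N * R N i i)))
  else if i < k then
    X ^ N * (C (a i * b k) *
      (R N i (k + 1) + X ^ (N + 1) * (geom A (N + 1) * R (N + 1) i i)))
  else X ^ N * (geom A N * R N i i)

/-- The linear system of `q`-difference equations for a grid of power series. -/
structure IsGrid (n : ℕ) (a b : ℕ → A) (R : ℕ → ℕ → ℕ → A⟦X⟧) : Prop where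
  step : ∀ N i k, 1 ≤ N → i < n → k < n →
    R N (i + 1) k - R N i k - R N (i + 1) (k + 1) + R N i (k + 1) =
      gridStep a b R i k N - gridStep a b R i k (N + 1)
  right : ∀ N p, 1 ≤ N → p ≤ n → R N p n = R (N + 1) p 0
  left : ∀ N m, 1 ≤ N → m ≤ n → R N 0 m = R (N + 1) n m

theorem gridStep_sub (a b : ℕ → A) (R R' : ℕ → ℕ → ℕ → A⟦X⟧) (i k N : ℕ) :
    gridStep a b (fun N p m => R N p m - R' N p m) i k N =
      gridStep a b R i k N - gridStep a b R' i k N := by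
  unfold gridStep
  split_ifs <;> ring

theorem IsGrid.sub {n : ℕ} {a b : ℕ → A} {R R' : ℕ → ℕ → ℕ → A⟦X⟧} (h : IsGrid n a b R)
    (h' : IsGrid n a b R') : IsGrid n a b (fun N p m => R N p m - R' N p m) where
  step N i k hN hi hk := by
    simp only [gridStep_sub]
    linear_combination h.step N i k hN hi hk - h'.step N i k hN hi hk
  right N p hN hp := by rw [h.right N p hN hp, h'.right N p hN hp]
  left N m hN hm := by rw [h.left N m hN hm, h'.left N m hN hm]

/-- Each case of `gridStep` carries a factor X ^ N with N ≥ 1: this is the power of X gained in each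
round of `IsGrid.eq_zero`. -/
theorem X_pow_dvd_gridStep {n t : ℕ} {a b : ℕ → A} {R : ℕ → ℕ → ℕ → A⟦X⟧}
    (h : ∀ N p m, 1 ≤ N → p ≤ n → m ≤ n → X ^ t ∣ R N p m) {i k N : ℕ} (hN : 1 ≤ N)
    (hi : i < n) (hk : k < n) : X ^ (t + 1) ∣ gridStep a b R i k N := by
  have hX : (X : A⟦X⟧) ∣ X ^ N := dvd_pow_self _ (by omega)
  rw [pow_succ']
  unfold gridStep
  split_ifs
  · exact mul_dvd_mul hX (Dvd.dvd.mul_left (dvd_add (h _ _ _ hN (by omega) (by omega))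
      (((h _ _ _ hN (by omega) (by omega)).mul_left _).mul_left _)) _)
  · exact mul_dvd_mul hX (Dvd.dvd.mul_left (dvd_add (h _ _ _ hN (by omega) (by omega))
      (((h _ _ _ (by omega) (by omega) (by omega)).mul_left _).mul_left _)) _)
  · exact mul_dvd_mul hX ((h _ _ _ hN (by omega) (by omega)).mul_left _)

/-- Divisibility by X ^ t improves to X ^ (t + 1), first for rectangle differences. The boundary
equations turn these into increments in N, which can be summed because E tends to 0. -/
theorem IsGrid.eq_zero {n : ℕ} {a b : ℕ → A} {E : ℕ → ℕ → ℕ → A⟦X⟧} (h : IsGrid n a b E)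
    (h0 : ∀ N p m, 1 ≤ N → p ≤ n → m ≤ n → X ^ N ∣ E N p m) {N p m : ℕ} (hN : 1 ≤ N)
    (hp : p ≤ n) (hm : m ≤ n) : E N p m = 0 := by
  have key : ∀ t N p m, 1 ≤ N → p ≤ n → m ≤ n → X ^ t ∣ E N p m := by
    intro t
    induction t with
    | zero => simp
    | succ t ih =>
      have rect : ∀ N p m, 1 ≤ N → p ≤ n → m ≤ n →
          X ^ (t + 1) ∣ E N p m - E N p 0 - E N 0 m + E N 0 0 := fun N p m hN hp hm =>
        dvd_rectangle (e := E N) (fun i k hi hk => by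
          rw [h.step N i k hN hi hk]
          exact dvd_sub (X_pow_dvd_gridStep ih hN hi hk)
            (X_pow_dvd_gridStep ih (by omega) hi hk)) hp hm
      have e1 : ∀ N p, 1 ≤ N → p ≤ n → X ^ (t + 1) ∣ E N p 0 - E N 0 0 := by
        intro N p hN hp
        refine X_pow_dvd_of_X_pow_dvd_sub (f := fun N => E N p 0 - E N 0 0) (fun N hN => ?_)
          (fun N hN => dvd_sub (h0 _ _ _ hN hp (by omega)) (h0 _ _ _ hN (by omega) (by omega))) hN
        -- By `right`, the rectangle with m = n is the increment from N to N + 1 of E N p 0 - E N 0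
        -- 0.
        have := rect N p n hN hp le_rfl
        rw [h.right N p hN hp, h.right N 0 hN (by omega)] at this
        rw [← dvd_neg]
        convert this using 1
        ring
      have e2 : ∀ N, 1 ≤ N → X ^ (t + 1) ∣ E N n 0 := by
        intro N hN
        refine X_pow_dvd_of_X_pow_dvd_sub (f := fun N => E N n 0) (fun N hN => ?_)
          (fun N hN => h0 _ _ _ hN le_rfl (by omega)) hN
        -- By `left`, E N 0 0 = E (N + 1) n 0, so this too is an increment in N.
        have := e1 N n hN le_rfl
        rwa [h.left N 0 hN (by omega)] at this
      have e3 : ∀ N p, 1 ≤ N → p ≤ n → X ^ (t + 1) ∣ E N p 0 := by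
        intro N p hN hp
        have := dvd_add (dvd_sub (e1 N p hN hp) (e1 N n hN le_rfl)) (e2 N hN)
        convert this using 1
        ring
      have e4 : ∀ N m, 1 ≤ N → m ≤ n → X ^ (t + 1) ∣ E N n m := by
        intro N m hN hm
        refine X_pow_dvd_of_X_pow_dvd_sub (f := fun N => E N n m) (fun N hN => ?_)
          (fun N hN => h0 _ _ _ hN le_rfl hm) hN
        have := dvd_add (rect N n m hN le_rfl hm) (e1 N n hN le_rfl)
        rw [h.left N m hN hm] at this
        convert this using 1
        ring
      intro N p m hN hp hm
      have h4 : X ^ (t + 1) ∣ E N 0 m := by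
        rw [h.left N m hN hm]
        exact e4 _ _ (by omega) hm
      have := dvd_add (dvd_add (rect N p m hN hp hm) (e1 N p hN hp)) h4
      convert this using 1
      ring
  ext d
  exact X_pow_dvd_iff.mp (key (d + 1) N p m hN hp hm) d (by omega)

theorem IsGrid.eq_of_tendsto {n : ℕ} {a b : ℕ → A} {R R' : ℕ → ℕ → ℕ → A⟦X⟧}
    (h : IsGrid n a b R) (h' : IsGrid n a b R')
    (h0 : ∀ N p m, 1 ≤ N → p ≤ n → m ≤ n → X ^ N ∣ R N p m - 1)
    (h0' : ∀ N p m, 1 ≤ N → p ≤ n → m ≤ n → X ^ N ∣ R' N p m - 1) {N p m : ℕ} (hN : 1 ≤ N)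
    (hp : p ≤ n) (hm : m ≤ n) : R N p m = R' N p m :=
  sub_eq_zero.mp ((h.sub h').eq_zero (fun N p m hN hp hm => by
    simpa using dvd_sub (h0 N p m hN hp hm) (h0' N p m hN hp hm)) hN hp hm)

end Algebra

/-! ### Summability of families of power series -/

section Summation

open PowerSeries
open scoped PowerSeries.WithPiTopology

variable {A : Type*} [CommRing A] [TopologicalSpace A]

theorem hasSum_of_eq {ι M : Type*} [AddCommMonoid M] [TopologicalSpace M] {f g : ι → M} {x : M}
    (hg : HasSum g x) (h : ∀ t, f t = g t) : HasSum f x := by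
  rwa [funext h]

theorem summable_of_finite_coeff {ι : Type*} {f : ι → A⟦X⟧}
    (h : ∀ m, {t | coeff m (f t) ≠ 0}.Finite) : Summable f :=
  (WithPiTopology.summable_iff_summable_coeff A).2 fun d => summable_of_hasFiniteSupport (h d)

theorem summable_of_X_pow_dvd {f : ℕ → A⟦X⟧} (h : ∀ r, X ^ r ∣ f r) : Summable f := by
  refine summable_of_finite_coeff fun m => (Set.finite_Iic m).subset fun r hr => ?_
  by_contra hlt
  exact hr (X_pow_dvd_iff.mp (h r) m (not_le.mp hlt))

end Summation

/-! ### The explicit solution built from rows -/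

section Solution

open PowerSeries
open scoped PowerSeries.WithPiTopology

variable {A : Type*} [CommRing A]

/-- The coefficient `x^r (q; q)_r / (x q; q)_r` with `x = q^N`. -/
noncomputable def rho (A : Type*) [CommRing A] (N r : ℕ) : A⟦X⟧ :=
  X ^ (N * r) * ∏ j ∈ Finset.range r, (1 - X ^ (j + 1)) * geom A (N + j + 1)

/-- The coefficient `x^r (q; q)_r / (x q²; q)_r` with `x = q^N`. -/
noncomputable def sigma (A : Type*) [CommRing A] (N r : ℕ) : A⟦X⟧ :=
  X ^ (N * r) * ∏ j ∈ Finset.range r, (1 - X ^ (j + 1)) * geom A (N + j + 2)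

theorem rho_succ (N r : ℕ) :
    rho A N (r + 1) = X ^ N * ((1 - X ^ (r + 1)) * geom A (N + r + 1)) * rho A N r := by
  rw [rho, rho, Finset.prod_range_succ]
  ring

theorem sigma_succ (N r : ℕ) :
    sigma A N (r + 1) = X ^ N * ((1 - X ^ (r + 1)) * geom A (N + r + 2)) * sigma A N r := by
  rw [sigma, sigma, Finset.prod_range_succ]
  ring

/-- The factor X ^ r is the one produced by the shift relations of `IsRowPair`; hence `sigma` at
level N meets `rho` at level N + 1 across the boundary of the grid. -/
theorem rho_add_one (N r : ℕ) : rho A (N + 1) r = X ^ r * sigma A N r := by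
  rw [rho, sigma]
  simp only [show ∀ j, N + 1 + j + 1 = N + j + 2 by intro j; ring]
  ring

theorem sigma_mul (N r : ℕ) :
    sigma A N r * (1 - X ^ (N + r + 1)) = rho A N r * (1 - X ^ (N + 1)) := by
  induction r with
  | zero => simp [rho, sigma]
  | succ r ih =>
    rw [sigma_succ, rho_succ]
    have h1 := one_sub_X_pow_mul_geom (A := A) (N := N + r + 1) (by omega)
    have h2 := one_sub_X_pow_mul_geom (A := A) (N := N + r + 2) (by omega)
    rw [show N + (r + 1) + 1 = N + r + 2 by ring]
    linear_combination X ^ N * (1 - X ^ (r + 1)) * sigma A N r * h2 -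
      X ^ N * (1 - X ^ (r + 1)) * sigma A N r * h1 +
      X ^ N * (1 - X ^ (r + 1)) * geom A (N + r + 1) * ih

theorem sigma_eq (N r : ℕ) :
    sigma A N r = rho A N r * (1 - X ^ (N + 1)) * geom A (N + r + 1) := by
  have h1 := one_sub_X_pow_mul_geom (A := A) (N := N + r + 1) (by omega)
  linear_combination geom A (N + r + 1) * sigma_mul (A := A) N r - sigma A N r * h1

/-- Coefficient form of `IsGrid.step` for k < i: the index r + 1 comes from the mixed difference,
the right side from `gridStep`. The cases i < k and i = k rest on `geom_mul_sigma_succ` and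
`rho_succ_sub_rho`. -/
theorem geom_mul_rho_succ {N : ℕ} (hN : 1 ≤ N) (r : ℕ) :
    geom A N * rho A N (r + 1) =
      X ^ N * geom A N * rho A N r - X ^ (N + 1) * geom A (N + 1) * rho A (N + 1) r := by
  have h0 := one_sub_X_pow_mul_geom (A := A) hN
  have h1 := one_sub_X_pow_mul_geom (A := A) (N := N + 1) (by omega)
  have h2 := one_sub_X_pow_mul_geom (A := A) (N := N + r + 1) (by omega)
  rw [rho_succ, rho_add_one, sigma_eq]
  linear_combination X ^ N * rho A N r *
    (geom A N * h2 - X ^ (r + 1) * geom A (N + r + 1) * h0 +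
      X ^ (r + 1) * geom A (N + r + 1) * h1)

theorem geom_mul_sigma_succ (N r : ℕ) :
    geom A (N + 1) * sigma A N (r + 1) =
      X ^ N * geom A (N + 1) * sigma A N r -
        X ^ (N + 1) * geom A (N + 2) * sigma A (N + 1) r := by
  have h0 := one_sub_X_pow_mul_geom (A := A) (N := N + 1) (by omega)
  have h1 := one_sub_X_pow_mul_geom (A := A) (N := N + 2) (by omega)
  have h2 := one_sub_X_pow_mul_geom (A := A) (N := N + r + 2) (by omega)
  rw [sigma_succ, sigma_eq (N + 1), rho_add_one, show N + 1 + 1 = N + 2 by ring,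
    show N + 1 + r + 1 = N + r + 2 by ring]
  linear_combination X ^ N * sigma A N r *
    (geom A (N + 1) * h2 - X ^ (r + 1) * geom A (N + r + 2) * h0 +
      X ^ (r + 1) * geom A (N + r + 2) * h1)

theorem rho_succ_sub_rho {N : ℕ} (r : ℕ) :
    rho A N (r + 1) - rho A N r + (1 - X ^ N) * geom A (N + 1) * sigma A N r = 0 := by
  have h1 := one_sub_X_pow_mul_geom (A := A) (N := N + 1) (by omega)
  have h2 := one_sub_X_pow_mul_geom (A := A) (N := N + r + 1) (by omega)
  rw [rho_succ, sigma_eq]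
  linear_combination rho A N r * (h2 + (1 - X ^ N) * geom A (N + r + 1) * h1)

theorem X_pow_dvd_rho {N r : ℕ} : X ^ (N * r) ∣ rho A N r := Dvd.intro _ rfl

theorem X_pow_dvd_sigma {N r : ℕ} : X ^ (N * r) ∣ sigma A N r := Dvd.intro _ rfl

theorem X_pow_dvd_rho' {N : ℕ} (hN : 1 ≤ N) (r : ℕ) : X ^ r ∣ rho A N r :=
  (pow_dvd_pow X (Nat.le_mul_of_pos_left r hN)).trans X_pow_dvd_rho

theorem X_pow_dvd_sigma' {N : ℕ} (hN : 1 ≤ N) (r : ℕ) : X ^ r ∣ sigma A N r :=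
  (pow_dvd_pow X (Nat.le_mul_of_pos_left r hN)).trans X_pow_dvd_sigma

theorem rho_add_one' (N : ℕ) : rho A (N + 1) = fun r => sigma A N r * X ^ r := by
  ext1 r
  rw [rho_add_one, mul_comm]

/-- At N = 1 the quotient (q; q)_r / (q²; q)_r telescopes to (1 - q) / (1 - q^{r+1}). -/
theorem rho_one (r : ℕ) : rho A 1 r * (1 - X ^ (r + 1)) = X ^ r * (1 - X) := by
  induction r with
  | zero => simp [rho]
  | succ r ih =>
    have := one_sub_X_pow_mul_geom (A := A) (N := 1 + r + 1) (by omega)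
    rw [rho_succ]
    rw [show r + 1 + 1 = 1 + r + 1 by ring]
    linear_combination (X * (1 - X ^ (r + 1)) * rho A 1 r) * this + X * ih

/-- The relations between the generating functions `U r p` and `V r m` of rows of length `r` of
Frobenius partitions whose parts are bounded below by `0_{a_p}`, resp. `0_{b_m}`. -/
structure IsRowPair (n : ℕ) (a b : ℕ → A) (U V : ℕ → ℕ → A⟦X⟧) : Prop where
  left_zero : ∀ p, U 0 p = 1
  left_succ : ∀ r p, p < n → U (r + 1) (p + 1) = U (r + 1) p + C (a p) * U r p
  left_shift : ∀ r, U r 0 = X ^ r * U r n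
  right_zero : ∀ m, V 0 m = 1
  right_succ : ∀ r m, m < n → V (r + 1) m = V (r + 1) (m + 1) + C (b m) * V r (m + 1)
  right_shift : ∀ r, V r n = X ^ r * V r 0

variable [TopologicalSpace A]

/-- The series `∑ c_r U_r V_r`. -/
noncomputable def rowSum (U V : ℕ → ℕ → A⟦X⟧) (c : ℕ → A⟦X⟧) (p m : ℕ) : A⟦X⟧ :=
  ∑' r, c r * (U r p * V r m)

/-- The explicit solution of the grid system built from the rows of Frobenius partitions. -/
noncomputable def rowGrid (U V : ℕ → ℕ → A⟦X⟧) (N p m : ℕ) : A⟦X⟧ :=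
  if m ≤ p then
    geom A N * (rowSum U V (rho A N) p m - X ^ N * rowSum U V (rho A N) p p)
  else
    geom A (N + 1) *
      (rowSum U V (sigma A N) p m - X ^ (N + 1) * rowSum U V (rho A (N + 1)) p p)

theorem summable_rowSum {U V : ℕ → ℕ → A⟦X⟧} {c : ℕ → A⟦X⟧} (hc : ∀ r, X ^ r ∣ c r) (p m : ℕ) :
    Summable fun r => c r * (U r p * V r m) :=
  summable_of_X_pow_dvd fun r => (hc r).mul_right _

theorem IsRowPair.rowSum_right {n : ℕ} {a b : ℕ → A}
    {U V : ℕ → ℕ → A⟦X⟧} (h : IsRowPair n a b U V) (c : ℕ → A⟦X⟧) (p : ℕ) :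
    rowSum U V c p n = rowSum U V (fun r => c r * X ^ r) p 0 := by
  unfold rowSum
  congr 1 with r : 1
  rw [h.right_shift]
  ring

theorem IsRowPair.rowSum_left {n : ℕ} {a b : ℕ → A}
    {U V : ℕ → ℕ → A⟦X⟧} (h : IsRowPair n a b U V) (c : ℕ → A⟦X⟧) (m : ℕ) :
    rowSum U V c 0 m = rowSum U V (fun r => c r * X ^ r) n m := by
  unfold rowSum
  congr 1 with r : 1
  rw [h.left_shift]
  ring

theorem rowGrid_of_le {U V : ℕ → ℕ → A⟦X⟧} {N p m : ℕ} (hmp : m ≤ p) :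
    rowGrid U V N p m =
      geom A N * (rowSum U V (rho A N) p m - X ^ N * rowSum U V (rho A N) p p) := if_pos hmp

theorem rowGrid_self {U V : ℕ → ℕ → A⟦X⟧} {N p : ℕ} (hN : 1 ≤ N) :
    rowGrid U V N p p = rowSum U V (rho A N) p p := by
  rw [rowGrid_of_le le_rfl]
  linear_combination rowSum U V (rho A N) p p * one_sub_X_pow_mul_geom (A := A) hN

variable [DiscreteTopology A]

/-- Transfers a linear relation between coefficient sequences to the series; three terms are enough
for every use. -/
theorem rowSum_linear {U V : ℕ → ℕ → A⟦X⟧} {c d e : ℕ → A⟦X⟧} (hc : ∀ r, X ^ r ∣ c r)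
    (hd : ∀ r, X ^ r ∣ d r) (he : ∀ r, X ^ r ∣ e r) {x y z : A⟦X⟧} (p m : ℕ)
    (h : ∀ r, x * c r + y * d r + z * e r = 0) :
    x * rowSum U V c p m + y * rowSum U V d p m + z * rowSum U V e p m = 0 := by
  have hc' := (summable_rowSum (U := U) (V := V) hc p m).hasSum.mul_left x
  have hd' := (summable_rowSum (U := U) (V := V) hd p m).hasSum.mul_left y
  have he' := (summable_rowSum (U := U) (V := V) he p m).hasSum.mul_left z
  refine ((hc'.add hd').add he').unique ?_
  refine hasSum_of_eq (g := fun _ => 0) hasSum_zero fun r => ?_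
  linear_combination (U r p * V r m) * h r

/-- The difference in p strips a part 0_{a_i} from the first row and the difference in m strips
0_{b_k} from the second, so both rows lose one part. -/
theorem IsRowPair.rowSum_step {n : ℕ} {a b : ℕ → A} {U V : ℕ → ℕ → A⟦X⟧}
    (h : IsRowPair n a b U V) {c : ℕ → A⟦X⟧} (hc : ∀ r, X ^ r ∣ c r) {i k : ℕ} (hi : i < n)
    (hk : k < n) :
    rowSum U V c (i + 1) k - rowSum U V c i k - rowSum U V c (i + 1) (k + 1) +
      rowSum U V c i (k + 1) =
    C (a i * b k) * rowSum U V (fun r => c (r + 1)) i (k + 1) := by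
  have hs := fun p m => (summable_rowSum (U := U) (V := V) hc p m).hasSum
  have hc' : ∀ r, X ^ r ∣ c (r + 1) := fun r => (pow_dvd_pow X (by omega)).trans (hc (r + 1))
  have h1 := (((hs (i + 1) k).sub (hs i k)).sub (hs (i + 1) (k + 1))).add (hs i (k + 1))
  refine h1.unique ?_
  -- The term r = 0 equals c 0 at all four corners and cancels.
  rw [← hasSum_nat_add_iff' 1]
  have h2 := (summable_rowSum (U := U) (V := V) hc' i (k + 1)).hasSum.mul_left (C (a i * b k))
  rw [Finset.sum_range_one, h.left_zero, h.left_zero, h.right_zero, h.right_zero, sub_self,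
    zero_sub, neg_add_cancel, sub_zero]
  refine hasSum_of_eq h2 fun r => ?_
  rw [h.left_succ r i hi, h.right_succ r k hk, map_mul]
  ring

/-- The two formulas defining `rowGrid` agree on the diagonal, so a unit square off the diagonal
needs only one of them even when it touches the diagonal. -/
theorem rowGrid_of_ge {U V : ℕ → ℕ → A⟦X⟧} {N p m : ℕ} (hN : 1 ≤ N) (hmp : p ≤ m) :
    rowGrid U V N p m = geom A (N + 1) *
      (rowSum U V (sigma A N) p m - X ^ (N + 1) * rowSum U V (rho A (N + 1)) p p) := by
  rcases hmp.lt_or_eq with hlt | rfl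
  · exact if_neg (by omega)
  · rw [rowGrid_self hN]
    have := rowSum_linear (U := U) (V := V) (c := rho A N) (d := sigma A N) (e := rho A (N + 1))
      (x := 1) (y := - geom A (N + 1)) (z := geom A (N + 1) * X ^ (N + 1))
      (X_pow_dvd_rho' hN) (X_pow_dvd_sigma' hN) (X_pow_dvd_rho' (by omega)) p p (fun r => by
        rw [rho_add_one]
        linear_combination - geom A (N + 1) * sigma_mul (A := A) N r -
          rho A N r * one_sub_X_pow_mul_geom (A := A) (N := N + 1) (by omega))
    linear_combination this

theorem IsRowPair.isGrid {n : ℕ} {a b : ℕ → A} {U V : ℕ → ℕ → A⟦X⟧} (h : IsRowPair n a b U V)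
    (hab : ∀ i, i < n → a i * b i = 1) : IsGrid n a b (rowGrid U V) where
  step N i k hN hi hk := by
    unfold gridStep
    have hN1 : 1 ≤ N + 1 := by omega
    have hN2 : 1 ≤ N + 1 + 1 := by omega
    have g0 := one_sub_X_pow_mul_geom (A := A) hN
    have hr0 := X_pow_dvd_rho' (A := A) hN
    have hr1 := X_pow_dvd_rho' (A := A) hN1
    have hs0 := X_pow_dvd_sigma' (A := A) hN
    have hs1 := X_pow_dvd_sigma' (A := A) hN1
    rcases lt_trichotomy k i with hki | rfl | hik
    · rw [if_pos hki, if_pos hki, rowGrid_self hN, rowGrid_self hN1,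
        rowGrid_of_le (by omega : k ≤ i + 1), rowGrid_of_le (by omega : k ≤ i),
        rowGrid_of_le (by omega : k + 1 ≤ i + 1), rowGrid_of_le (by omega : k + 1 ≤ i),
        rowGrid_of_le (by omega : k + 1 ≤ i)]
      have e1 := h.rowSum_step hr0 hi hk
      have e2 := rowSum_linear (U := U) (V := V) (c := fun r => rho A N (r + 1)) (d := rho A N)
        (e := rho A (N + 1)) (x := geom A N) (y := - (X ^ N * geom A N))
        (z := X ^ (N + 1) * geom A (N + 1))
        (fun r => (pow_dvd_pow X (by omega)).trans (hr0 (r + 1))) hr0 hr1 i (k + 1) (fun r => by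
          linear_combination geom_mul_rho_succ (A := A) hN r)
      linear_combination geom A N * e1 + C (a i * b k) * e2
    -- The diagonal square mixes both formulas: only the corner (k, k + 1) lies above the diagonal.
    -- The weight disappears because a_k b_k = 1.
    · rw [if_neg (lt_irrefl _), if_neg (lt_irrefl _), if_neg (lt_irrefl _), if_neg (lt_irrefl _),
        rowGrid_self hN, rowGrid_self hN, rowGrid_self hN1, rowGrid_of_le (by omega : k ≤ k + 1),
        rowGrid_of_ge hN (by omega : k ≤ k + 1)]
      have e1 := h.rowSum_step hr0 hi hk
      have e2 := rowSum_linear (U := U) (V := V) (c := fun r => rho A N (r + 1)) (d := rho A N)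
        (e := sigma A N) (x := 1) (y := -1)
        (z := (1 - X ^ N) * geom A (N + 1))
        (fun r => (pow_dvd_pow X (by omega)).trans (hr0 (r + 1))) hr0 hs0 k (k + 1) (fun r => by
          linear_combination rho_succ_sub_rho (A := A) (N := N) r)
      rw [hab k hk, map_one] at e1
      linear_combination geom A N * e1 + geom A N * e2 +
        (rowSum U V (rho A N) k k + rowSum U V (rho A N) (k + 1) (k + 1) -
          geom A (N + 1) * rowSum U V (sigma A N) k (k + 1)) * g0
    · rw [if_neg (by omega), if_pos hik, if_neg (by omega), if_pos hik, rowGrid_self hN1,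
        rowGrid_self hN2, rowGrid_of_ge hN (by omega : i + 1 ≤ k), rowGrid_of_ge hN hik.le,
        rowGrid_of_ge hN (by omega : i + 1 ≤ k + 1), rowGrid_of_ge hN (by omega : i ≤ k + 1),
        rowGrid_of_ge hN1 (by omega : i ≤ k + 1)]
      have e1 := h.rowSum_step hs0 hi hk
      have e2 := rowSum_linear (U := U) (V := V) (c := fun r => sigma A N (r + 1)) (d := sigma A N)
        (e := sigma A (N + 1)) (x := geom A (N + 1)) (y := - (X ^ N * geom A (N + 1)))
        (z := X ^ (N + 1) * geom A (N + 2))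
        (fun r => (pow_dvd_pow X (by omega)).trans (hs0 (r + 1))) hs0 hs1 i (k + 1) (fun r => by
          linear_combination geom_mul_sigma_succ (A := A) N r)
      linear_combination geom A (N + 1) * e1 + C (a i * b k) * e2
  right N p hN hp := by
    rw [rowGrid_of_ge hN hp, rowGrid_of_le (Nat.zero_le p), h.rowSum_right, ← rho_add_one']
  left N m hN hm := by
    rw [rowGrid_of_ge hN (Nat.zero_le m), rowGrid_of_le hm, h.rowSum_left, ← rho_add_one',
      h.rowSum_left (rho A (N + 1)) 0, h.rowSum_right (rho A (N + 1)) n]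

theorem X_pow_dvd_rowSum_sub_one {U V : ℕ → ℕ → A⟦X⟧} (hU : ∀ p, U 0 p = 1) (hV : ∀ m, V 0 m = 1)
    {c : ℕ → A⟦X⟧} {N : ℕ} (hN : 1 ≤ N) (hc : ∀ r, X ^ (N * r) ∣ c r) (h0 : c 0 = 1) (p m : ℕ) :
    X ^ N ∣ rowSum U V c p m - 1 := by
  have hc' : ∀ r, X ^ r ∣ c r := fun r =>
    (pow_dvd_pow X (Nat.le_mul_of_pos_left r hN)).trans (hc r)
  have hs := summable_rowSum (U := U) (V := V) hc' p m
  rw [rowSum, hs.tsum_eq_zero_add, h0, hU, hV, mul_one, mul_one, add_sub_cancel_left]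
  -- The cofactor retains X ^ r so that the series left after extracting X ^ N still converges.
  have hd : ∀ r, ∃ f, c (r + 1) * (U (r + 1) p * V (r + 1) m) = X ^ N * (X ^ r * f) := by
    intro r
    obtain ⟨f, hf⟩ := hc (r + 1)
    refine ⟨X ^ (N * r - r) * f * (U (r + 1) p * V (r + 1) m), ?_⟩
    have : N * (r + 1) = N + (r + (N * r - r)) := by
      have := Nat.le_mul_of_pos_left r hN
      rw [mul_add]
      omega
    rw [hf, this, pow_add, pow_add]
    ring
  choose f hf using hd
  simp_rw [hf]
  rw [(summable_of_X_pow_dvd (f := fun r => X ^ r * f r) fun r => Dvd.intro _ rfl).tsum_mul_left]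
  exact Dvd.intro _ rfl

theorem IsRowPair.X_pow_dvd_rowGrid_sub_one {n : ℕ} {a b : ℕ → A} {U V : ℕ → ℕ → A⟦X⟧}
    (h : IsRowPair n a b U V) {N : ℕ} (hN : 1 ≤ N) (p m : ℕ) :
    X ^ N ∣ rowGrid U V N p m - 1 := by
  have hN1 : 1 ≤ N + 1 := by omega
  have e : ∀ N, 1 ≤ N → ∀ p m, X ^ N ∣ rowSum U V (rho A N) p m - 1 := fun N hN p m =>
    X_pow_dvd_rowSum_sub_one h.left_zero h.right_zero hN (fun r => X_pow_dvd_rho) (by simp [rho])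
      p m
  rcases le_total m p with hmp | hmp
  · rw [rowGrid_of_le hmp]
    have := dvd_sub ((e N hN p m).mul_left (geom A N))
      ((e N hN p p).mul_left (geom A N * X ^ N))
    convert this using 1
    linear_combination one_sub_X_pow_mul_geom (A := A) hN
  · rw [rowGrid_of_ge hN hmp]
    have e' : X ^ N ∣ rowSum U V (sigma A N) p m - 1 :=
      X_pow_dvd_rowSum_sub_one h.left_zero h.right_zero hN (fun r => X_pow_dvd_sigma)
        (by simp [sigma]) p m
    have := dvd_sub (e'.mul_left (geom A (N + 1))) (((pow_dvd_pow X (by omega)).trans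
      (e (N + 1) hN1 p p)).mul_left (geom A (N + 1) * X ^ (N + 1)))
    convert this using 1
    linear_combination one_sub_X_pow_mul_geom (A := A) hN1

/-- Since V_r(n) = q^r V_r(0), the coefficient of U_r(n) V_r(0) is `rho` at N = 1 times (1 -
q^{r+1}) / (1 - q), which is q^r by `rho_one`. -/
theorem IsRowPair.rowGrid_one {n : ℕ} {a b : ℕ → A} {U V : ℕ → ℕ → A⟦X⟧}
    (h : IsRowPair n a b U V) :
    rowGrid U V 1 n 0 = ∑' r, X ^ r * (U r n * V r 0) := by
  rw [rowGrid_of_le (Nat.zero_le n), h.rowSum_right]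
  have hr := X_pow_dvd_rho' (A := A) le_rfl
  have e := rowSum_linear (U := U) (V := V) (c := rho A 1) (d := fun r => rho A 1 r * X ^ r)
    (e := fun r => X ^ r) (x := geom A 1) (y := - (geom A 1 * X ^ 1)) (z := -1) hr
    (fun r => (hr r).mul_right _) (fun r => dvd_rfl) n 0 (fun r => by
      have := one_sub_X_pow_mul_geom (A := A) le_rfl
      linear_combination geom A 1 * rho_one (A := A) r + X ^ r * this)
  change _ = rowSum U V (fun r => X ^ r) n 0
  linear_combination e

end Solution

/-! ### The grid of Primc generating functions -/

section PrimcGrid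

open PowerSeries

variable {A : Type*} [CommRing A]

/-- The minimal difference `Δ(a_i b_k, a_{i'} b_{k'})` as a natural number. -/
def natDiff (i k i' k' : ℕ) : ℕ :=
  (if i' ≤ i ∧ ¬ (i = k ∧ k = i') then 1 else 0) + (if k ≤ k' ∧ ¬ (k = i' ∧ i' = k') then 1 else 0)

theorem minDiff_eq_natDiff {n : ℕ} (c d : Colour n) :
    minDiff c d = natDiff c.1 c.2 d.1 d.2 := by
  obtain ⟨i, k⟩ := c
  obtain ⟨i', k'⟩ := d
  simp only [minDiff, natDiff, ge_iff_le, Fin.ext_iff, Fin.le_def]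
  split_ifs <;> first | rfl | omega

/-- The recursion for generating functions `G N i k` of Primc partitions whose smallest part is at
least `N` and has colour `a_i b_k`. -/
structure IsPrimcSystem (n : ℕ) (a b : ℕ → A) (G : ℕ → ℕ → ℕ → A⟦X⟧) : Prop where
  step : ∀ N i k, 1 ≤ N → i < n → k < n → G N i k - G (N + 1) i k =
    X ^ N * (C (a i * b k) * (1 + ∑ i' ∈ Finset.range n, ∑ k' ∈ Finset.range n,
      G (N + natDiff i' k' i k) i' k'))
  dvd : ∀ N i k, 1 ≤ N → X ^ N ∣ G N i k

/-- The generating functions of Primc partitions whose smallest part is at least `N`, increased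
by one for each of the conditions `p ≤ i`, `k < m` satisfied by its colour `a_i b_k`. -/
noncomputable def primcGrid (n : ℕ) (G : ℕ → ℕ → ℕ → A⟦X⟧) (N p m : ℕ) : A⟦X⟧ :=
  1 + ∑ i ∈ Finset.range n, ∑ k ∈ Finset.range n,
    G (N + (if p ≤ i then 1 else 0) + (if k < m then 1 else 0)) i k

theorem sum_sum_eq_single {M : Type*} [AddCommMonoid M] {n i k : ℕ} (hi : i < n) (hk : k < n)
    {f : ℕ → ℕ → M} (h : ∀ i' k', ¬ (i' = i ∧ k' = k) → f i' k' = 0) :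
    ∑ i' ∈ Finset.range n, ∑ k' ∈ Finset.range n, f i' k' = f i k := by
  rw [Finset.sum_eq_single_of_mem i (Finset.mem_range.2 hi), Finset.sum_eq_single_of_mem k
    (Finset.mem_range.2 hk)]
  · exact fun k' _ hne => h _ _ fun h => hne h.2
  · exact fun i' _ hne => Finset.sum_eq_zero fun k' _ => h _ _ fun h => hne h.1

/-- Moving p from i to i + 1 affects only colours with first index i, and moving m from k to k + 1
only those with second index k; the mixed difference sees a_i b_k alone. -/
theorem primcGrid_step {n : ℕ} (G : ℕ → ℕ → ℕ → A⟦X⟧) {N i k : ℕ} (hi : i < n) (hk : k < n) :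
    primcGrid n G N (i + 1) k - primcGrid n G N i k - primcGrid n G N (i + 1) (k + 1) +
      primcGrid n G N i (k + 1) =
    G N i k - G (N + 1) i k - (G (N + 1) i k - G (N + 2) i k) := by
  have : primcGrid n G N (i + 1) k - primcGrid n G N i k - primcGrid n G N (i + 1) (k + 1) +
      primcGrid n G N i (k + 1) = ∑ i' ∈ Finset.range n, ∑ k' ∈ Finset.range n,
      (G (N + (if i + 1 ≤ i' then 1 else 0) + (if k' < k then 1 else 0)) i' k' -
        G (N + (if i ≤ i' then 1 else 0) + (if k' < k then 1 else 0)) i' k' -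
        G (N + (if i + 1 ≤ i' then 1 else 0) + (if k' < k + 1 then 1 else 0)) i' k' +
        G (N + (if i ≤ i' then 1 else 0) + (if k' < k + 1 then 1 else 0)) i' k') := by
    simp only [Finset.sum_add_distrib, Finset.sum_sub_distrib, primcGrid]
    ring
  rw [this, sum_sum_eq_single hi hk]
  · simp only [show ¬ i + 1 ≤ i by omega, lt_irrefl, le_refl, if_true, if_false, add_zero,
      Nat.lt_succ_self, show N + 1 + 1 = N + 2 by rfl]
    ring
  · intro i' k' hne
    rcases ne_or_eq i' i with h | rfl
    · simp only [show i + 1 ≤ i' ↔ i ≤ i' by omega]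
      ring
    · have h : k' ≠ k := fun h => hne ⟨rfl, h⟩
      simp only [show k' < k + 1 ↔ k' < k by omega]
      ring

/-- Before the colour a_l b_l, Δ equals χ(l ≤ i) + χ(k < l) except at i = k = l, where Δ is 0
instead of 1. -/
theorem sum_natDiff_self {n : ℕ} (G : ℕ → ℕ → ℕ → A⟦X⟧) {N l : ℕ} (hl : l < n) :
    1 + ∑ i ∈ Finset.range n, ∑ k ∈ Finset.range n, G (N + natDiff i k l l) i k =
      primcGrid n G N l l + (G N l l - G (N + 1) l l) := by
  have : 1 + ∑ i ∈ Finset.range n, ∑ k ∈ Finset.range n, G (N + natDiff i k l l) i k -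
      primcGrid n G N l l = ∑ i ∈ Finset.range n, ∑ k ∈ Finset.range n,
      (G (N + natDiff i k l l) i k -
        G (N + (if l ≤ i then 1 else 0) + (if k < l then 1 else 0)) i k) := by
    simp only [Finset.sum_sub_distrib, primcGrid]
    ring
  rw [← sub_eq_iff_eq_add', this, sum_sum_eq_single hl hl]
  · simp [natDiff]
  · intro i k hne
    rw [add_assoc, show natDiff i k l l = (if l ≤ i then 1 else 0) + (if k < l then 1 else 0) by
      unfold natDiff; split_ifs <;> omega, sub_self]

/-- Here Δ has the form of the grid entry (i, k + 1) except at the colour a_i b_i, where it is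
smaller by one. -/
theorem sum_natDiff_of_ne {n : ℕ} (G : ℕ → ℕ → ℕ → A⟦X⟧) {N i k : ℕ} (hi : i < n) (hik : i ≠ k) :
    1 + ∑ i' ∈ Finset.range n, ∑ k' ∈ Finset.range n, G (N + natDiff i' k' i k) i' k' =
      primcGrid n G N i (k + 1) + (G (N + if i < k then 1 else 0) i i -
        G (N + (if i < k then 1 else 0) + 1) i i) := by
  have : 1 + ∑ i' ∈ Finset.range n, ∑ k' ∈ Finset.range n, G (N + natDiff i' k' i k) i' k' -
      primcGrid n G N i (k + 1) = ∑ i' ∈ Finset.range n, ∑ k' ∈ Finset.range n,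
      (G (N + natDiff i' k' i k) i' k' -
        G (N + (if i ≤ i' then 1 else 0) + (if k' < k + 1 then 1 else 0)) i' k') := by
    simp only [Finset.sum_sub_distrib, primcGrid]
    ring
  rw [← sub_eq_iff_eq_add', this, sum_sum_eq_single hi hi]
  · congr 2
    · unfold natDiff
      split_ifs <;> omega
    · split_ifs <;> omega
  · intro i' k' hne
    rw [add_assoc, show natDiff i' k' i k =
      (if i ≤ i' then 1 else 0) + (if k' < k + 1 then 1 else 0) by
      unfold natDiff; split_ifs <;> omega, sub_self]

/-- As a_l b_l = 1, the difference D satisfies D = X^N (R + D) with R the diagonal grid entry;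
solving for D is the origin of `geom` in `gridStep`. -/
theorem IsPrimcSystem.sub_self {n : ℕ} {a b : ℕ → A} {G : ℕ → ℕ → ℕ → A⟦X⟧}
    (h : IsPrimcSystem n a b G) (hab : ∀ i, i < n → a i * b i = 1) {N l : ℕ} (hN : 1 ≤ N)
    (hl : l < n) : G N l l - G (N + 1) l l = X ^ N * (geom A N * primcGrid n G N l l) := by
  have h1 := h.step N l l hN hl hl
  rw [sum_natDiff_self G hl, hab l hl, map_one, one_mul] at h1
  linear_combination (geom A N) * h1 -
    (G N l l - G (N + 1) l l) * one_sub_X_pow_mul_geom (A := A) hN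

theorem IsPrimcSystem.gridStep_eq {n : ℕ} {a b : ℕ → A} {G : ℕ → ℕ → ℕ → A⟦X⟧}
    (h : IsPrimcSystem n a b G) (hab : ∀ i, i < n → a i * b i = 1) {N i k : ℕ} (hN : 1 ≤ N)
    (hi : i < n) (hk : k < n) :
    gridStep a b (primcGrid n G) i k N = G N i k - G (N + 1) i k := by
  unfold gridStep
  split_ifs with h1 h2
  · rw [h.step N i k hN hi hk, sum_natDiff_of_ne G hi (by omega), if_neg (by omega), add_zero,
      h.sub_self hab hN hi]
  · rw [h.step N i k hN hi hk, sum_natDiff_of_ne G hi (by omega), if_pos h2,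
      h.sub_self hab (by omega) hi]
  · obtain rfl : i = k := by omega
    rw [h.sub_self hab hN hi]

theorem IsPrimcSystem.isGrid {n : ℕ} {a b : ℕ → A} {G : ℕ → ℕ → ℕ → A⟦X⟧}
    (h : IsPrimcSystem n a b G) (hab : ∀ i, i < n → a i * b i = 1) :
    IsGrid n a b (primcGrid n G) where
  step N i k hN hi hk := by
    rw [h.gridStep_eq hab hN hi hk, h.gridStep_eq hab (by omega) hi hk, primcGrid_step G hi hk]
  right N p _ _ := by
    unfold primcGrid
    congr 1
    refine Finset.sum_congr rfl fun i _ => Finset.sum_congr rfl fun k hk => ?_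
    rw [if_pos (Finset.mem_range.1 hk), if_neg (Nat.not_lt_zero k), add_zero, add_right_comm]
  left N m _ _ := by
    unfold primcGrid
    congr 1
    refine Finset.sum_congr rfl fun i hi => Finset.sum_congr rfl fun k _ => ?_
    rw [if_pos (Nat.zero_le i), if_neg (not_le.2 (Finset.mem_range.1 hi)), add_zero]

theorem IsPrimcSystem.X_pow_dvd_primcGrid_sub_one {n : ℕ} {a b : ℕ → A} {G : ℕ → ℕ → ℕ → A⟦X⟧}
    (h : IsPrimcSystem n a b G) {N : ℕ} (hN : 1 ≤ N) (p m : ℕ) :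
    X ^ N ∣ primcGrid n G N p m - 1 := by
  rw [primcGrid, add_sub_cancel_left]
  refine Finset.dvd_sum fun i _ => Finset.dvd_sum fun k _ => ?_
  exact (pow_dvd_pow X (by omega)).trans (h.dvd _ i k (by omega))

open scoped PowerSeries.WithPiTopology in
theorem IsPrimcSystem.one_add_sum {n : ℕ} {a b : ℕ → A} {G : ℕ → ℕ → ℕ → A⟦X⟧}
    [TopologicalSpace A] [DiscreteTopology A]
    (h : IsPrimcSystem n a b G) (hab : ∀ i, i < n → a i * b i = 1) {U V : ℕ → ℕ → A⟦X⟧}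
    (h' : IsRowPair n a b U V) :
    1 + ∑ i ∈ Finset.range n, ∑ k ∈ Finset.range n, G 1 i k =
      ∑' r, X ^ r * (U r n * V r 0) := by
  rw [← h'.rowGrid_one, ← (h.isGrid hab).eq_of_tendsto (h'.isGrid hab)
    (fun N p m hN _ _ => h.X_pow_dvd_primcGrid_sub_one hN p m)
    (fun N p m hN _ _ => h'.X_pow_dvd_rowGrid_sub_one hN p m) le_rfl le_rfl (Nat.zero_le n)]
  unfold primcGrid
  congr 1
  refine Finset.sum_congr rfl fun i hi => Finset.sum_congr rfl fun k _ => ?_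
  rw [if_neg (not_le.2 (Finset.mem_range.1 hi)), if_neg (Nat.not_lt_zero k)]

end PrimcGrid

/-! ### Lists of coloured parts and their generating functions -/

section Lists

variable {γ : Type*}

@[simp] theorem size_nil : size ([] : List (ℕ × γ)) = 0 := rfl

@[simp] theorem size_cons (p : ℕ × γ) (l : List (ℕ × γ)) : size (p :: l) = p.1 + size l := by
  simp [size]

theorem size_reverse (l : List (ℕ × γ)) : size l.reverse = size l := by
  simp [size, List.sum_reverse]

theorem le_size_of_mem {p : ℕ × γ} {l : List (ℕ × γ)} (h : p ∈ l) : p.1 ≤ size l :=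
  List.le_sum_of_mem (List.mem_map_of_mem h)

theorem length_le_size {l : List (ℕ × γ)} (h : ∀ p ∈ l, 0 < p.1) : l.length ≤ size l := by
  induction l with
  | nil => simp
  | cons p l ih =>
    have h1 := h p (by simp)
    have h2 := ih fun q hq => h q (by simp [hq])
    simp only [List.length_cons, size_cons]
    omega

theorem finite_length_le_size_le [Finite γ] (M m : ℕ) :
    {l : List (ℕ × γ) | l.length ≤ M ∧ size l ≤ m}.Finite := by
  refine ((List.finite_length_le (Fin (m + 1) × γ) M).image
    (List.map (Prod.map Fin.val id))).subset ?_
  rintro l ⟨h1, h2⟩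
  refine ⟨l.map (fun p => (Fin.ofNat (m + 1) p.1, p.2)), by simpa using h1, ?_⟩
  rw [List.map_map]
  conv_rhs => rw [← List.map_id l]
  refine List.map_congr_left fun p hp => Prod.ext ?_ rfl
  exact Nat.mod_eq_of_lt (by have := le_size_of_mem hp; omega)

/-- A set of lists of coloured parts with finitely many lists of each size. -/
def SizeFinite (S : Set (List (ℕ × γ))) : Prop := ∀ m, {l ∈ S | size l = m}.Finite

theorem SizeFinite.mono {S T : Set (List (ℕ × γ))} (hT : SizeFinite T) (h : S ⊆ T) :
    SizeFinite S := fun m => (hT m).subset fun _ hl => ⟨h hl.1, hl.2⟩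

theorem sizeFinite_pos [Finite γ] : SizeFinite {l : List (ℕ × γ) | ∀ p ∈ l, 0 < p.1} := fun m =>
  (finite_length_le_size_le m m).subset fun _ hl =>
    ⟨(length_le_size hl.1).trans hl.2.le, hl.2.le⟩

/-- Zero parts are allowed here, so the size does not bound the length; distinctness does, as only
finitely many coloured parts are at most m. -/
theorem sizeFinite_nodup [Finite γ] : SizeFinite {l : List (ℕ × γ) | l.Nodup} := by
  intro m
  cases nonempty_fintype γ
  classical
  refine (finite_length_le_size_le (Finset.range (m + 1) ×ˢ (Finset.univ : Finset γ)).card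
    m).subset fun l hl => ⟨?_, hl.2.le⟩
  rw [← List.toFinset_card_of_nodup hl.1]
  refine Finset.card_le_card fun p hp => ?_
  have := le_size_of_mem (List.mem_toFinset.1 hp)
  simp only [Finset.mem_product, Finset.mem_range, Finset.mem_univ, and_true]
  have := hl.2
  omega

open PowerSeries

variable {A : Type*} [CommRing A]

/-- The monomial of a list of coloured parts: `q` to the power its size, times the product of the
weights of the colours. -/
noncomputable def listWt (w : γ → A) (l : List (ℕ × γ)) : A⟦X⟧ :=
  monomial (size l) (l.map fun p => w p.2).prod

theorem listWt_nil (w : γ → A) : listWt w [] = 1 := by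
  simp [listWt, monomial_zero_eq_C]

theorem listWt_cons (w : γ → A) (p : ℕ × γ) (l : List (ℕ × γ)) :
    listWt w (p :: l) = X ^ p.1 * C (w p.2) * listWt w l := by
  rw [listWt, listWt, X_pow_eq, ← monomial_zero_eq_C_apply, monomial_mul_monomial,
    monomial_mul_monomial, size_cons, List.map_cons, List.prod_cons, add_zero, one_mul]

theorem listWt_reverse (w : γ → A) (l : List (ℕ × γ)) : listWt w l.reverse = listWt w l := by
  simp [listWt, size_reverse, List.prod_reverse]

theorem size_eq_of_coeff_listWt_ne_zero {w : γ → A} {l : List (ℕ × γ)} {m : ℕ}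
    (h : coeff m (listWt w l) ≠ 0) : size l = m := by
  by_contra hne
  exact h (by rw [listWt, coeff_monomial, if_neg (Ne.symm hne)])

open scoped PowerSeries.WithPiTopology

variable [TopologicalSpace A]

theorem SizeFinite.summable {S : Set (List (ℕ × γ))} (hS : SizeFinite S) (w : γ → A) :
    Summable fun l : S => listWt w (l : List (ℕ × γ)) :=
  summable_of_finite_coeff fun m => ((hS m).preimage Subtype.val_injective.injOn).subset
    fun l hl => ⟨l.2, size_eq_of_coeff_listWt_ne_zero hl⟩

/-- The generating function of a set of lists of coloured parts. -/
noncomputable def listGf (w : γ → A) (S : Set (List (ℕ × γ))) : A⟦X⟧ :=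
  ∑' l : S, listWt w (l : List (ℕ × γ))

theorem listGf_nil (w : γ → A) : listGf w {[]} = 1 := by
  simp [listGf, listWt_nil]

theorem listGf_reverse (w : γ → A) (S : Set (List (ℕ × γ))) :
    listGf w (List.reverse '' S) = listGf w S := by
  rw [listGf, tsum_image _ List.reverse_injective.injOn]
  simp only [listWt_reverse]
  rfl

variable [DiscreteTopology A]

theorem listGf_union {S T : Set (List (ℕ × γ))} (w : γ → A) (hS : SizeFinite S)
    (hT : SizeFinite T) (hd : Disjoint S T) :
    listGf w (S ∪ T) = listGf w S + listGf w T :=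
  (hS.summable w).tsum_union_disjoint hd (hT.summable w)

theorem listGf_cons {S : Set (List (ℕ × γ))} (w : γ → A) (hS : SizeFinite S) (p : ℕ × γ) :
    listGf w (List.cons p '' S) = X ^ p.1 * (C (w p.2) * listGf w S) := by
  rw [listGf, tsum_image _ List.cons_injective.injOn, listGf]
  simp only [listWt_cons]
  rw [(hS.summable w).tsum_mul_left, mul_assoc]

theorem listGf_iUnion {ι : Type*} [Fintype ι] {S : ι → Set (List (ℕ × γ))} (w : γ → A)
    (hS : ∀ i, SizeFinite (S i)) (hd : Pairwise (Function.onFun Disjoint S)) :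
    listGf w (⋃ i, S i) = ∑ i, listGf w (S i) := by
  rw [show (⋃ i, S i) = ⋃ i ∈ Finset.univ, S i by simp]
  exact Summable.tsum_finset_bUnion_disjoint (f := listWt w) (s := Finset.univ) (t := S)
    (fun i _ j _ hij => hd hij) (fun i _ => (hS i).summable w)

theorem coeff_listGf {S : Set (List (ℕ × γ))} (w : γ → A) (hS : SizeFinite S) (m : ℕ) :
    coeff m (listGf w S) = ∑' l : S, coeff m (listWt w (l : List (ℕ × γ))) :=
  (((WithPiTopology.hasSum_iff_hasSum_coeff A).1 (hS.summable w).hasSum) m).tsum_eq.symm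

theorem X_pow_dvd_listGf {S : Set (List (ℕ × γ))} (w : γ → A) (hS : SizeFinite S) {N : ℕ}
    (h : ∀ l ∈ S, N ≤ size l) : X ^ N ∣ listGf w S := by
  rw [X_pow_dvd_iff]
  intro m hm
  rw [coeff_listGf w hS]
  refine (tsum_congr fun l => ?_).trans tsum_zero
  by_contra hne
  have h1 := size_eq_of_coeff_listWt_ne_zero hne
  have h2 := h l l.2
  omega

end Lists

/-! ### The recursion for Primc partitions -/

section PrimcLists

/-- `p` may follow `p'` when the parts of a Primc partition are listed in increasing order. -/
def primcRel {n : ℕ} (p' p : ℕ × Colour n) : Prop :=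
  p'.1 + natDiff p.2.1 p.2.2 p'.2.1 p'.2.2 ≤ p.1

/-- The Primc partitions, listed in increasing order, whose smallest part is at least `N` and has
colour `a_i b_k`. -/
def primcFrom (n N i k : ℕ) : Set (List (ℕ × Colour n)) :=
  {l | ∃ p t, l = p :: t ∧ N ≤ p.1 ∧ (p.2.1 : ℕ) = i ∧ (p.2.2 : ℕ) = k ∧
    (p :: t).IsChain primcRel}

theorem le_of_isChain_primcRel {n : ℕ} {p : ℕ × Colour n} {t : List (ℕ × Colour n)}
    (h : (p :: t).IsChain primcRel) : ∀ q ∈ p :: t, p.1 ≤ q.1 := by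
  induction t generalizing p with
  | nil => simp
  | cons p' t ih =>
    rw [List.isChain_cons_cons] at h
    intro q hq
    rcases List.mem_cons.1 hq with rfl | hq
    · exact le_rfl
    · have := ih h.2 q hq
      have := h.1
      unfold primcRel at this
      omega

theorem sizeFinite_primcFrom {n N i k : ℕ} (hN : 1 ≤ N) : SizeFinite (primcFrom n N i k) := by
  refine sizeFinite_pos.mono ?_
  rintro _ ⟨p, t, rfl, h1, -, -, h2⟩ q hq
  have := le_of_isChain_primcRel h2 q hq
  omega

theorem disjoint_primcFrom {n N N' i k i' k' : ℕ} (h : ¬ (i = i' ∧ k = k')) :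
    Disjoint (primcFrom n N i k) (primcFrom n N' i' k') := by
  rw [Set.disjoint_left]
  rintro _ ⟨p, t, rfl, -, h1, h2, -⟩ ⟨p', t', he, -, h1', h2', -⟩
  obtain ⟨rfl, rfl⟩ := List.cons.inj he
  exact h ⟨h1.symm.trans h1', h2.symm.trans h2'⟩

/-- The lists of parts which are empty or begin with a part of size at least `f c`, where `c` is
its colour. -/
def primcTail (n : ℕ) (f : ℕ → ℕ → ℕ) : Set (List (ℕ × Colour n)) :=
  {[]} ∪ ⋃ c : Colour n, primcFrom n (f c.1 c.2) c.1 c.2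

theorem sizeFinite_primcTail {n : ℕ} {f : ℕ → ℕ → ℕ} (hf : ∀ i k, 1 ≤ f i k) :
    SizeFinite (primcTail n f) := by
  refine sizeFinite_pos.mono ?_
  rintro l (rfl | hl)
  · simp
  · obtain ⟨c, _, _, rfl, h1, -, -, h2⟩ := Set.mem_iUnion.1 hl
    intro q hq
    have := le_of_isChain_primcRel h2 q hq
    have := hf c.1 c.2
    omega

/-- The smallest part, at the head, either exceeds N or equals N; in the second case the chain
condition becomes a threshold for the next part. -/
theorem primcFrom_eq {n N i k : ℕ} (hi : i < n) (hk : k < n) :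
    primcFrom n N i k = primcFrom n (N + 1) i k ∪
      List.cons (N, (⟨i, hi⟩, ⟨k, hk⟩)) '' primcTail n (fun i' k' => N + natDiff i' k' i k) := by
  ext l
  constructor
  · rintro ⟨⟨v, c, d⟩, t, rfl, h1, rfl, rfl, h2⟩
    rcases h1.lt_or_eq with h | h
    · exact Or.inl ⟨_, t, rfl, h, rfl, rfl, h2⟩
    · change N = v at h
      subst h
      refine Or.inr ⟨t, ?_, rfl⟩
      cases t with
      | nil => exact Or.inl rfl
      | cons p' t =>
        rw [List.isChain_cons_cons] at h2
        exact Or.inr (Set.mem_iUnion.2 ⟨p'.2, p', t, rfl, h2.1, rfl, rfl, h2.2⟩)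
  · rintro (⟨p, t, rfl, h1, h2⟩ | ⟨t, ht, rfl⟩)
    · exact ⟨p, t, rfl, by omega, h2⟩
    · refine ⟨_, t, rfl, le_rfl, rfl, rfl, ?_⟩
      rcases ht with rfl | ht
      · simp
      · obtain ⟨c, p', t, rfl, h1, h2, h3, h4⟩ := Set.mem_iUnion.1 ht
        rw [List.isChain_cons_cons]
        refine ⟨?_, h4⟩
        unfold primcRel
        rw [h2, h3]
        exact h1

open PowerSeries
open scoped PowerSeries.WithPiTopology

variable {A : Type*} [CommRing A] [TopologicalSpace A] [DiscreteTopology A]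

/-- The weight `a_i b_k` of the colour `(i, k)`. -/
def colourWt {n : ℕ} (a b : ℕ → A) (c : Colour n) : A := a c.1 * b c.2

theorem listGf_primcTail {n : ℕ} (a b : ℕ → A) {f : ℕ → ℕ → ℕ} (hf : ∀ i k, 1 ≤ f i k) :
    listGf (colourWt a b) (primcTail n f) = 1 + ∑ i ∈ Finset.range n, ∑ k ∈ Finset.range n,
      listGf (colourWt a b) (primcFrom n (f i k) i k) := by
  have hU : SizeFinite (⋃ c : Colour n, primcFrom n (f c.1 c.2) c.1 c.2) :=
    (sizeFinite_primcTail hf).mono Set.subset_union_right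
  have h0 : SizeFinite ({[]} : Set (List (ℕ × Colour n))) :=
    (sizeFinite_primcTail hf).mono Set.subset_union_left
  rw [primcTail, listGf_union _ h0 hU, listGf_nil, listGf_iUnion _
    (fun c => sizeFinite_primcFrom (hf _ _)), Fintype.sum_prod_type]
  · simp only [Finset.sum_range]
  · intro c d hcd
    refine disjoint_primcFrom fun h => hcd (Prod.ext (Fin.ext h.1) (Fin.ext h.2))
  · rw [Set.disjoint_left]
    rintro _ rfl h
    obtain ⟨c, p', t, h, -⟩ := Set.mem_iUnion.1 h
    simp at h

theorem isPrimcSystem (n : ℕ) (a b : ℕ → A) :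
    IsPrimcSystem n a b fun N i k => listGf (colourWt a b) (primcFrom n N i k) where
  step N i k hN hi hk := by
    have ht := sizeFinite_primcTail (n := n) (f := fun i' k' => N + natDiff i' k' i k)
      (fun i k => by omega)
    have hc : SizeFinite (List.cons (N, (⟨i, hi⟩, ⟨k, hk⟩)) ''
        primcTail n (fun i' k' => N + natDiff i' k' i k)) :=
      (sizeFinite_primcFrom hN).mono (by rw [primcFrom_eq hi hk]; exact Set.subset_union_right)
    rw [sub_eq_iff_eq_add', primcFrom_eq hi hk, listGf_union _ (sizeFinite_primcFrom (by omega)) hc,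
      listGf_cons _ ht, listGf_primcTail _ _ (fun i k => by omega)]
    · rfl
    · rw [Set.disjoint_left]
      rintro _ ⟨p, t, rfl, h, -⟩ ⟨t', -, he⟩
      obtain ⟨rfl, rfl⟩ := List.cons.inj he
      simp at h
  dvd N i k hN := by
    refine X_pow_dvd_listGf _ (sizeFinite_primcFrom hN) ?_
    rintro _ ⟨p, t, rfl, h, -⟩
    rw [size_cons]
    omega

/-- Since Δ is never negative, parts increase weakly from the smallest one, so positivity need only
be required of that part. -/
theorem setOf_isPrimc_eq (n : ℕ) :
    {l : List (ℕ × Colour n) | IsPrimc l} = List.reverse '' primcTail n (fun _ _ => 1) := by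
  have hrel : (fun p' p : ℕ × Colour n => minDiff p.2 p'.2 ≤ (p.1 : ℤ) - (p'.1 : ℤ)) =
      primcRel := by
    funext p' p
    rw [minDiff_eq_natDiff, primcRel, eq_iff_iff]
    omega
  ext l
  obtain ⟨l', rfl⟩ := List.reverse_surjective l
  rw [List.reverse_injective.mem_set_image, Set.mem_ofPred_eq, IsPrimc, List.isChain_reverse, hrel]
  simp only [List.mem_reverse]
  constructor
  · rintro ⟨h1, h2⟩
    cases l' with
    | nil => exact Or.inl rfl
    | cons p t => exact Or.inr (Set.mem_iUnion.2 ⟨p.2, p, t, rfl, h1 p (by simp), rfl, rfl, h2⟩)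
  · rintro (h | h)
    · obtain rfl : l' = [] := h
      simp
    · obtain ⟨c, p, t, rfl, h1, -, -, h2⟩ := Set.mem_iUnion.1 h
      refine ⟨fun q hq => ?_, h2⟩
      have h1 : 1 ≤ p.1 := h1
      have := le_of_isChain_primcRel h2 q hq
      omega

theorem listGf_isPrimc (n : ℕ) {a b : ℕ → A} (hab : ∀ i, i < n → a i * b i = 1)
    {U V : ℕ → ℕ → A⟦X⟧} (h : IsRowPair n a b U V) :
    listGf (colourWt a b) {l : List (ℕ × Colour n) | IsPrimc l} =
      ∑' r, X ^ r * (U r n * V r 0) := by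
  rw [setOf_isPrimc_eq, listGf_reverse, listGf_primcTail _ _ (fun _ _ => le_rfl),
    ← (isPrimcSystem n a b).one_add_sum hab h]

end PrimcLists

/-! ### Rows of Frobenius partitions -/

section Rows

/-- The rows coloured by the `a_i`, listed in increasing order, all of whose parts are greater than
`K_{a_p}`. -/
def rowSet (n K p : ℕ) : Set (List (ℕ × Fin n)) :=
  {l | l.Pairwise (fun y z => gtA z y) ∧ ∀ y ∈ l, K < y.1 ∨ (K = y.1 ∧ (y.2 : ℕ) < p)}

theorem sizeFinite_rowSet (n K p : ℕ) : SizeFinite (rowSet n K p) := by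
  refine sizeFinite_nodup.mono fun l hl => hl.1.imp fun {y z} h heq => ?_
  subst heq
  rcases h with h | h
  · exact lt_irrefl _ h
  · exact lt_irrefl _ h.2

theorem rowSet_zero (n K : ℕ) : rowSet n K 0 = rowSet n (K + 1) n := by
  ext l
  refine and_congr_right fun _ => forall₂_congr fun y _ => ?_
  have := y.2.2
  omega

/-- The only newly admitted part K_{a_p} is the least admissible one, so it can occur only at the
head, with the rest of the row above it. -/
theorem rowSet_succ {n K p : ℕ} (hp : p < n) :
    rowSet n K (p + 1) = rowSet n K p ∪ List.cons (K, ⟨p, hp⟩) '' rowSet n K p := by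
  ext l
  constructor
  · rintro ⟨h1, h2⟩
    cases l with
    | nil => exact Or.inl ⟨h1, by simp⟩
    | cons y t =>
      rw [List.pairwise_cons] at h1
      rcases y with ⟨v, i⟩
      have hy := h2 _ List.mem_cons_self
      simp only at hy
      have htail : ∀ z ∈ t, v < z.1 ∨ v = z.1 ∧ (z.2 : ℕ) < i := fun z hz => h1.1 z hz
      by_cases hvi : v = K ∧ (i : ℕ) = p
      · obtain ⟨rfl, rfl⟩ := hvi
        exact Or.inr ⟨t, ⟨h1.2, htail⟩, rfl⟩
      · refine Or.inl ⟨List.pairwise_cons.2 h1, ?_⟩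
        intro z hz
        rcases List.mem_cons.1 hz with rfl | hz
        · simp only
          omega
        · have := htail z hz
          omega
  · rintro (⟨h1, h2⟩ | ⟨t, ⟨h1, h2⟩, rfl⟩)
    · refine ⟨h1, fun y hy => ?_⟩
      have := h2 y hy
      omega
    · refine ⟨List.pairwise_cons.2 ⟨fun z hz => h2 z hz, h1⟩, fun z hz => ?_⟩
      rcases List.mem_cons.1 hz with rfl | hz
      · simp
      · have := h2 z hz
        omega

theorem disjoint_rowSet_cons {n K p : ℕ} (hp : p < n) (S : Set (List (ℕ × Fin n))) :
    Disjoint (rowSet n K p) (List.cons (K, ⟨p, hp⟩) '' S) := by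
  rw [Set.disjoint_left]
  rintro _ ⟨-, h⟩ ⟨t, -, rfl⟩
  have := h _ List.mem_cons_self
  simp at this

/-- Adding one to all parts of a row. -/
def shiftRow {γ : Type*} (l : List (ℕ × γ)) : List (ℕ × γ) := l.map fun y => (y.1 + 1, y.2)

theorem shiftRow_injective {γ : Type*} : Function.Injective (shiftRow (γ := γ)) :=
  List.map_injective_iff.2 fun y z h => by
    simp only [Prod.mk.injEq, Nat.add_right_cancel_iff] at h
    exact Prod.ext h.1 h.2

theorem shiftRow_image_rowSet (n : ℕ) : shiftRow '' rowSet n 0 n = rowSet n 0 0 := by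
  have e : ∀ l : List (ℕ × Fin n), (shiftRow l).Pairwise (fun y z => gtA z y) ↔
      l.Pairwise (fun y z => gtA z y) := by
    intro l
    rw [shiftRow, List.pairwise_map]
    simp [gtA]
  ext l
  constructor
  · rintro ⟨l, ⟨h1, -⟩, rfl⟩
    refine ⟨(e l).2 h1, fun y hy => ?_⟩
    obtain ⟨z, -, rfl⟩ := List.mem_map.1 hy
    simp
  · rintro ⟨h1, h2⟩
    have hl : shiftRow (l.map fun y => (y.1 - 1, y.2)) = l := by
      rw [shiftRow, List.map_map]
      conv_rhs => rw [← List.map_id l]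
      refine List.map_congr_left fun y hy => Prod.ext ?_ rfl
      have := h2 y hy
      simp only [Function.comp_apply, id_eq]
      omega
    refine ⟨l.map fun y => (y.1 - 1, y.2), ⟨(e _).1 (by rwa [hl]), fun y _ => ?_⟩, hl⟩
    have := y.2.2
    omega

open PowerSeries
open scoped PowerSeries.WithPiTopology

variable {A : Type*} [CommRing A]

theorem listWt_shiftRow {γ : Type*} (w : γ → A) (l : List (ℕ × γ)) :
    listWt w (shiftRow l) = X ^ l.length * listWt w l := by
  induction l with
  | nil => simp [shiftRow]
  | cons y t ih =>
    rw [shiftRow] at ih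
    rw [shiftRow, List.map_cons, listWt_cons, listWt_cons, ih, List.length_cons]
    ring

theorem setOf_length_eq_zero {γ : Type*} {S : Set (List γ)} (h : [] ∈ S) :
    {l ∈ S | l.length = 0} = {[]} := by
  ext l
  simp only [List.length_eq_zero_iff, Set.mem_ofPred_eq, Set.mem_singleton_iff]
  exact ⟨fun h => h.2, fun hl => ⟨hl ▸ h, hl⟩⟩

theorem nil_mem_rowSet (n K p : ℕ) : [] ∈ rowSet n K p := ⟨List.Pairwise.nil, by simp⟩

variable [TopologicalSpace A]

/-- The generating function of the rows of length `r` all of whose parts are greater than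
`0_{a_p}`. -/
noncomputable def rowGf {n : ℕ} (w : Fin n → A) (r p : ℕ) : A⟦X⟧ :=
  listGf w {l ∈ rowSet n 0 p | l.length = r}

theorem rowGf_zero {n : ℕ} (w : Fin n → A) (p : ℕ) : rowGf w 0 p = 1 := by
  rw [rowGf, setOf_length_eq_zero (nil_mem_rowSet n 0 p), listGf_nil]

variable [DiscreteTopology A]

theorem rowGf_succ {n : ℕ} (w : Fin n → A) (r : ℕ) {p : ℕ} (hp : p < n) :
    rowGf w (r + 1) (p + 1) = rowGf w (r + 1) p + C (w ⟨p, hp⟩) * rowGf w r p := by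
  have : {l ∈ rowSet n 0 (p + 1) | l.length = r + 1} = {l ∈ rowSet n 0 p | l.length = r + 1} ∪
      List.cons (0, ⟨p, hp⟩) '' {l ∈ rowSet n 0 p | l.length = r} := by
    rw [rowSet_succ hp]
    ext l
    constructor
    · rintro ⟨h | ⟨t, ht, rfl⟩, h2⟩
      · exact Or.inl ⟨h, h2⟩
      · exact Or.inr ⟨t, ⟨ht, by simpa using h2⟩, rfl⟩
    · rintro (h | ⟨t, ht, rfl⟩)
      · exact ⟨Or.inl h.1, h.2⟩
      · exact ⟨Or.inr ⟨t, ht.1, rfl⟩, by simpa using ht.2⟩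
  have hs : ∀ r, SizeFinite {l ∈ rowSet n 0 p | l.length = r} := fun r =>
    (sizeFinite_rowSet n 0 p).mono fun _ h => h.1
  rw [rowGf, this, listGf_union _ (hs _) _ _, listGf_cons _ (hs _), pow_zero, one_mul]
  · rfl
  · exact (sizeFinite_rowSet n 0 (p + 1)).mono (by
      rw [rowSet_succ hp]
      rintro _ ⟨t, ht, rfl⟩
      exact Or.inr ⟨t, ht.1, rfl⟩)
  · exact (disjoint_rowSet_cons hp _).mono_left fun _ h => h.1

theorem rowGf_shift {n : ℕ} (w : Fin n → A) (r : ℕ) :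
    rowGf w r 0 = X ^ r * rowGf w r n := by
  have : {l ∈ rowSet n 0 0 | l.length = r} = shiftRow '' {l ∈ rowSet n 0 n | l.length = r} := by
    rw [← shiftRow_image_rowSet]
    ext l
    constructor
    · rintro ⟨⟨t, ht, rfl⟩, h⟩
      exact ⟨t, ⟨ht, by simpa [shiftRow] using h⟩, rfl⟩
    · rintro ⟨t, ht, rfl⟩
      exact ⟨⟨t, ht.1, rfl⟩, by simpa [shiftRow] using ht.2⟩
  have hs : SizeFinite {l ∈ rowSet n 0 n | l.length = r} :=
    (sizeFinite_rowSet n 0 n).mono fun _ h => h.1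
  rw [rowGf, this, listGf, tsum_image _ shiftRow_injective.injOn, rowGf, listGf,
    ← (hs.summable w).tsum_mul_left]
  refine tsum_congr fun l => ?_
  rw [listWt_shiftRow, l.2.2]

/-- The b-order is the a-order with colours reversed, and the lower bound 0_{b_m} leaves n - m
colours for a zero part. -/
theorem isRowPair (n : ℕ) (a b : ℕ → A) :
    IsRowPair n a b (rowGf fun i : Fin n => a i)
      fun r m => rowGf (fun i : Fin n => b i.rev) r (n - m) where
  left_zero := rowGf_zero _
  left_succ r p hp := rowGf_succ _ r hp
  left_shift := rowGf_shift _
  right_zero m := rowGf_zero _ _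
  right_succ r m hm := by
    have h := rowGf_succ (fun i : Fin n => b i.rev) r (p := n - (m + 1)) (by omega)
    rw [show n - (m + 1) + 1 = n - m by omega] at h
    rw [h]
    congr 4
    rw [Fin.val_rev]
    simp only
    omega
  right_shift r := by
    rw [Nat.sub_self, Nat.sub_zero, rowGf_shift]

/-- The generating function of all rows as a finite product, up to large parts. -/
theorem listGf_rowSet_eq_mul {n : ℕ} (w : Fin n → A) (K : ℕ) :
    listGf w (rowSet n K n) =
      (∏ i : Fin n, (1 + C (w i) * X ^ K)) * listGf w (rowSet n (K + 1) n) := by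
  have key : ∀ p (hp : p ≤ n), listGf w (rowSet n K p) =
      (∏ i : Fin p, (1 + C (w (Fin.castLE hp i)) * X ^ K)) * listGf w (rowSet n (K + 1) n) := by
    intro p
    induction p with
    | zero => intro _; simp [rowSet_zero]
    | succ p ih =>
      intro hp
      rw [rowSet_succ hp, listGf_union _ (sizeFinite_rowSet n K p), listGf_cons _
        (sizeFinite_rowSet n K p), ih (by omega), Fin.prod_univ_castSucc]
      · simp only [Fin.castLE_castSucc]
        have : Fin.castLE hp (Fin.last p) = ⟨p, hp⟩ := rfl
        rw [this]
        ring
      · exact (sizeFinite_rowSet n K (p + 1)).mono (by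
          rw [rowSet_succ hp]
          exact Set.subset_union_right)
      · exact disjoint_rowSet_cons hp _
  exact key n le_rfl

theorem X_pow_dvd_listGf_rowSet_sub_one {n : ℕ} (w : Fin n → A) (K : ℕ) :
    X ^ K ∣ listGf w (rowSet n K n) - 1 := by
  have hs := sizeFinite_rowSet n K n
  have : rowSet n K n = {[]} ∪ rowSet n K n \ {[]} := by
    rw [Set.union_sdiff_cancel]
    exact Set.singleton_subset_iff.2 (nil_mem_rowSet n K n)
  rw [this, listGf_union _ (hs.mono (Set.singleton_subset_iff.2 (nil_mem_rowSet n K n)))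
    (hs.mono Set.sdiff_subset) Set.disjoint_sdiff_right, listGf_nil, add_sub_cancel_left]
  refine X_pow_dvd_listGf _ (hs.mono Set.sdiff_subset) ?_
  rintro l ⟨⟨-, h⟩, hl⟩
  cases l with
  | nil => simp at hl
  | cons y t =>
    have := h y List.mem_cons_self
    rw [size_cons]
    omega

end Rows

/-! ### Rows and infinite products -/

section Product

open PowerSeries
open scoped PowerSeries.WithPiTopology

variable {A : Type*} [CommRing A]

theorem qPochhammerInf_eq_mul (z : A⟦X⟧) :
    qPochhammerInf z = (1 - z) * qPochhammerInf (z * X) := by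
  let _ : TopologicalSpace A := ⊥
  have : DiscreteTopology A := ⟨rfl⟩
  have h := multipliable_qPochhammerInf (z * X)
  have e : ∀ k : ℕ, 1 - z * X ^ (k + 1) = 1 - z * X * X ^ k := fun k => by ring
  unfold qPochhammerInf
  rw [tprod_eq_zero_mul' (f := fun k : ℕ => 1 - z * X ^ k) (by simpa only [e] using h)]
  simp only [e, pow_zero, mul_one]

theorem X_pow_dvd_qPochhammerInf_sub_one {z : A⟦X⟧} {N : ℕ} (hz : X ^ N ∣ z) :
    X ^ N ∣ qPochhammerInf z - 1 := by
  let _ : TopologicalSpace A := ⊥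
  have : DiscreteTopology A := ⟨rfl⟩
  have h := (multipliable_qPochhammerInf z).hasProd
  -- The congruence involves finitely many coefficients, so it passes from finite products to the
  -- limit.
  have hc : IsClosed {f : A⟦X⟧ | X ^ N ∣ f - 1} := by
    have : {f : A⟦X⟧ | X ^ N ∣ f - 1} = ⋂ (m : ℕ) (_ : m < N),
        {f : A⟦X⟧ | coeff m f = coeff m (1 : A⟦X⟧)} := by
      ext f
      simp [X_pow_dvd_iff, sub_eq_zero]
    rw [this]
    exact isClosed_iInter fun m => isClosed_iInter fun _ =>
      isClosed_eq (WithPiTopology.continuous_coeff A m) continuous_const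
  refine hc.mem_of_tendsto h (Filter.Eventually.of_forall fun s => ?_)
  change (X : A⟦X⟧) ^ N ∣ (∏ k ∈ s, (1 - z * X ^ k)) - 1
  induction s using Finset.induction_on with
  | empty => simp
  | insert k s hk ih =>
    rw [Finset.prod_insert hk]
    have := dvd_sub ih ((hz.mul_right (X ^ k)).mul_right (∏ k ∈ s, (1 - z * X ^ k)))
    convert this using 1
    ring

theorem X_pow_dvd_prod_sub_one {ι B : Type*} [CommRing B] {d : B} (s : Finset ι) {f : ι → B}
    (h : ∀ i ∈ s, d ∣ f i - 1) : d ∣ ∏ i ∈ s, f i - 1 := by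
  classical
  induction s using Finset.induction_on with
  | empty => simp
  | insert k s hk ih =>
    rw [Finset.prod_insert hk]
    have := dvd_add ((h k (by simp)).mul_right (∏ i ∈ s, f i))
      (ih fun i hi => h i (by simp [hi]))
    convert this using 1
    ring

/-- Both sides obey the same recurrence from K + 1 to K and are 1 modulo X ^ K. They thus agree
modulo X ^ j for K ≥ j, and the recurrence carries this down to every K. -/
theorem listGf_rowSet_eq_prod [TopologicalSpace A] [DiscreteTopology A] {n : ℕ} (w : Fin n → A)
    (K : ℕ) :
    listGf w (rowSet n K n) = ∏ i : Fin n, qPochhammerInf (-(C (w i) * X ^ K)) := by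
  have key : ∀ j K, (X : A⟦X⟧) ^ j ∣ listGf w (rowSet n K n) -
      ∏ i : Fin n, qPochhammerInf (-(C (w i) * X ^ K)) := by
    intro j
    have h1 : ∀ K, j ≤ K → (X : A⟦X⟧) ^ j ∣ listGf w (rowSet n K n) -
        ∏ i : Fin n, qPochhammerInf (-(C (w i) * X ^ K)) := by
      intro K hK
      have := dvd_sub (X_pow_dvd_listGf_rowSet_sub_one w K) (X_pow_dvd_prod_sub_one Finset.univ
        (f := fun i : Fin n => qPochhammerInf (-(C (w i) * X ^ K))) fun i _ =>
        X_pow_dvd_qPochhammerInf_sub_one (dvd_neg.2 (dvd_mul_left _ _)))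
      rw [sub_sub_sub_cancel_right] at this
      exact (pow_dvd_pow X hK).trans this
    have h2 : ∀ i K, j ≤ K + i → (X : A⟦X⟧) ^ j ∣ listGf w (rowSet n K n) -
        ∏ i : Fin n, qPochhammerInf (-(C (w i) * X ^ K)) := by
      intro i
      induction i with
      | zero => exact h1
      | succ i ih =>
        intro K hK
        have := (ih (K + 1) (by omega)).mul_left (∏ i : Fin n, (1 + C (w i) * X ^ K))
        rw [mul_sub, ← listGf_rowSet_eq_mul, ← Finset.prod_mul_distrib] at this
        convert this using 3 with i
        rw [qPochhammerInf_eq_mul]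
        ring_nf
    exact fun K => h2 j K (by omega)
  rw [← sub_eq_zero]
  ext d
  exact X_pow_dvd_iff.mp (key (d + 1) K) d (by omega)

end Product

/-! ### Frobenius partitions as pairs of rows -/

section FrobeniusRows

open PowerSeries
open scoped PowerSeries.WithPiTopology

variable {γ : Type*} {A : Type*} [CommRing A]

theorem SizeFinite.finite_le {S : Set (List (ℕ × γ))} (hS : SizeFinite S) (m : ℕ) :
    {l ∈ S | size l ≤ m}.Finite :=
  ((Set.finite_Iic m).biUnion fun i _ => hS i).subset fun _ hl =>
    Set.mem_biUnion (Set.mem_Iic.2 hl.2) ⟨hl.1, rfl⟩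

theorem listWt_mul (w w' : γ → A) (l l' : List (ℕ × γ)) :
    listWt w l * listWt w' l' = monomial (size l + size l')
      ((l.map fun p => w p.2).prod * (l'.map fun p => w' p.2).prod) := by
  rw [listWt, listWt, monomial_mul_monomial]

theorem size_add_size_eq {w w' : γ → A} {l l' : List (ℕ × γ)} {k m : ℕ}
    (h : coeff m (X ^ k * listWt w l * listWt w' l') ≠ 0) : k + size l + size l' = m := by
  by_contra hne
  rw [mul_assoc, listWt_mul, X_pow_eq, monomial_mul_monomial, coeff_monomial, if_neg (by omega)]
    at h
  exact h rfl

theorem summable_mul [TopologicalSpace A] {S S' : Set (List (ℕ × γ))} (hS : SizeFinite S)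
    (hS' : SizeFinite S') (w w' : γ → A) (f : List (ℕ × γ) → ℕ) :
    Summable fun x : S × S' => X ^ f x.1 * listWt w x.1 * listWt w' (x.2 : List (ℕ × γ)) := by
  refine summable_of_finite_coeff fun m => ?_
  refine (((hS.finite_le m).prod (hS'.finite_le m)).preimage
    (f := fun x : S × S' => ((x.1 : List (ℕ × γ)), (x.2 : List (ℕ × γ)))) ?_).subset fun x hx => ?_
  · exact fun x _ y _ h => Prod.ext (Subtype.ext (Prod.ext_iff.1 h).1)
      (Subtype.ext (Prod.ext_iff.1 h).2)
  · have := size_add_size_eq hx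
    exact ⟨⟨x.1.2, show size (x.1 : List (ℕ × γ)) ≤ m by omega⟩,
      ⟨x.2.2, show size (x.2 : List (ℕ × γ)) ≤ m by omega⟩⟩

/-- The possible first rows of Frobenius partitions. -/
def rowsA (n : ℕ) : Set (List (ℕ × Fin n)) := {l | l.Pairwise gtA}

/-- The possible second rows of Frobenius partitions. -/
def rowsB (n : ℕ) : Set (List (ℕ × Fin n)) := {l | l.Pairwise gtB}

theorem reverse_image_rowSet (n : ℕ) : List.reverse '' rowSet n 0 n = rowsA n := by
  ext l
  obtain ⟨l, rfl⟩ := List.reverse_surjective l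
  rw [List.reverse_injective.mem_set_image, rowsA, Set.mem_ofPred_eq, List.pairwise_reverse]
  exact ⟨fun h => h.1, fun h => ⟨h, fun y _ => by have := y.2.2; omega⟩⟩

/-- Reversal of the order of the colours. -/
def revColour {n : ℕ} (l : List (ℕ × Fin n)) : List (ℕ × Fin n) :=
  l.map fun y => (y.1, y.2.rev)

theorem revColour_involutive {n : ℕ} : Function.Involutive (revColour (n := n)) := by
  intro l
  simp [revColour, Function.comp_def]

theorem revColour_image_rowsA (n : ℕ) : revColour '' rowsA n = rowsB n := by
  ext l
  obtain ⟨l, rfl⟩ := revColour_involutive.surjective l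
  rw [revColour_involutive.injective.mem_set_image, rowsA, rowsB, Set.mem_ofPred_eq,
    Set.mem_ofPred_eq, revColour, List.pairwise_map]
  refine iff_of_eq (congrArg (List.Pairwise · l) ?_)
  funext y z
  simp [gtA, gtB]

theorem listWt_revColour {n : ℕ} (w : Fin n → A) (l : List (ℕ × Fin n)) :
    listWt w (revColour l) = listWt (fun i => w i.rev) l := by
  simp [listWt, revColour, size, Function.comp_def]

theorem sizeFinite_rowsA (n : ℕ) : SizeFinite (rowsA n) := by
  refine sizeFinite_nodup.mono fun l hl => List.Pairwise.imp (fun {y z} h heq => ?_) hl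
  subst heq
  rcases h with h | h
  · exact lt_irrefl _ h
  · exact lt_irrefl _ h.2

theorem sizeFinite_rowsB (n : ℕ) : SizeFinite (rowsB n) := by
  refine sizeFinite_nodup.mono fun l hl => List.Pairwise.imp (fun {y z} h heq => ?_) hl
  subst heq
  rcases h with h | h
  · exact lt_irrefl _ h
  · exact lt_irrefl _ h.2

theorem image_sep_length {γ : Type*} {f : List γ → List γ} (hf : ∀ l, (f l).length = l.length)
    (S : Set (List γ)) (r : ℕ) :
    f '' {l ∈ S | l.length = r} = {l ∈ f '' S | l.length = r} := by
  ext l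
  constructor
  · rintro ⟨t, ht, rfl⟩
    exact ⟨⟨t, ht.1, rfl⟩, (hf t).trans ht.2⟩
  · rintro ⟨⟨t, ht, rfl⟩, h⟩
    exact ⟨t, ⟨ht, (hf t).symm.trans h⟩, rfl⟩

variable [TopologicalSpace A]

theorem listGf_revColour {n : ℕ} (w : Fin n → A) (S : Set (List (ℕ × Fin n))) :
    listGf w (revColour '' S) = listGf (fun i => w i.rev) S := by
  rw [listGf, tsum_image _ revColour_involutive.injective.injOn]
  simp only [listWt_revColour]
  rfl

theorem listGf_rowsA_length {n : ℕ} (w : Fin n → A) (r : ℕ) :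
    listGf w {l ∈ rowsA n | l.length = r} = rowGf w r n := by
  rw [← reverse_image_rowSet, ← image_sep_length (fun l => l.length_reverse), listGf_reverse, rowGf]

theorem listGf_rowsB_length {n : ℕ} (w : Fin n → A) (r : ℕ) :
    listGf w {l ∈ rowsB n | l.length = r} = rowGf (fun i => w i.rev) r n := by
  rw [← revColour_image_rowsA, ← image_sep_length (by simp [revColour]), listGf_revColour,
    listGf_rowsA_length]

/-- The generating function of Frobenius partitions. -/
noncomputable def frobeniusGf {n : ℕ} (w w' : Fin n → A) : A⟦X⟧ :=
  ∑' x : {r : List (ℕ × Fin n) × List (ℕ × Fin n) | IsFrobenius r},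
    X ^ x.1.1.length * listWt w x.1.1 * listWt w' x.1.2

theorem finite_frobeniusPartitions (n m : ℕ) : (frobeniusPartitions n m).Finite :=
  (((sizeFinite_rowsA n).finite_le m).prod ((sizeFinite_rowsB n).finite_le m)).subset
    fun x hx => by
      have := hx.2
      exact ⟨⟨hx.1.2.1, show size _ ≤ m by omega⟩, ⟨hx.1.2.2, show size _ ≤ m by omega⟩⟩

theorem summable_frobenius {n : ℕ} (w w' : Fin n → A) :
    Summable fun x : {r : List (ℕ × Fin n) × List (ℕ × Fin n) | IsFrobenius r} =>
      X ^ x.1.1.length * listWt w x.1.1 * listWt w' x.1.2 :=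
  summable_of_finite_coeff fun m => ((finite_frobeniusPartitions n m).preimage
    Subtype.val_injective.injOn).subset fun x hx => ⟨x.2, size_add_size_eq hx⟩

/-- Frobenius partitions sorted by their number of columns. -/
def frobeniusEquiv (n : ℕ) :
    (Σ r : ℕ, {l ∈ rowsA n | l.length = r} × {l ∈ rowsB n | l.length = r}) ≃
      {r : List (ℕ × Fin n) × List (ℕ × Fin n) | IsFrobenius r} where
  toFun x := ⟨(x.2.1.1, x.2.2.1), x.2.1.2.2.trans x.2.2.2.2.symm, x.2.1.2.1, x.2.2.2.1⟩
  invFun x := ⟨x.1.1.length, ⟨x.1.1, x.2.2.1, rfl⟩, ⟨x.1.2, x.2.2.2, x.2.1.symm⟩⟩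
  left_inv := by
    rintro ⟨r, ⟨l, hl, rfl⟩, ⟨l', hl'⟩⟩
    rfl
  right_inv _ := rfl

variable [DiscreteTopology A]

theorem frobeniusGf_eq_tsum {n : ℕ} (w w' : Fin n → A) :
    frobeniusGf w w' = ∑' r, X ^ r * (rowGf w r n * rowGf (fun i => w' i.rev) r n) := by
  have h := (frobeniusEquiv n).hasSum_iff.2 (summable_frobenius w w').hasSum
  refine (h.sigma fun r => ?_).tsum_eq.symm
  have hA : SizeFinite {l ∈ rowsA n | l.length = r} := (sizeFinite_rowsA n).mono fun _ h => h.1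
  have hB : SizeFinite {l ∈ rowsB n | l.length = r} := (sizeFinite_rowsB n).mono fun _ h => h.1
  have h1 := (hA.summable w).hasSum.mul (hB.summable w').hasSum
    (by simpa using summable_mul hA hB w w' fun _ => 0)
  have h2 := h1.mul_left (X ^ r)
  rw [← listGf_rowsA_length, ← listGf_rowsB_length]
  refine hasSum_of_eq h2 fun x => ?_
  have : (x.1 : List (ℕ × Fin n)).length = r := x.1.2.2
  change X ^ (x.1 : List (ℕ × Fin n)).length * _ * _ = _
  rw [this, mul_assoc]
  rfl

end FrobeniusRows

/-! ### The constant term of the product -/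

section ConstantTerm

open PowerSeries
open scoped PowerSeries.WithPiTopology
open LaurentPolynomial (T)

variable {A : Type*} [CommRing A]

/-- Extraction of the constant coefficient of a Laurent polynomial. -/
def constCoeff (A : Type*) [CommRing A] : LaurentPolynomial A →+ A where
  toFun f := f.coeff 0
  map_zero' := rfl
  map_add' _ _ := rfl

theorem hasSum_constTermX {ι : Type*} [TopologicalSpace A] [TopologicalSpace (LaurentPolynomial A)]
    [DiscreteTopology (LaurentPolynomial A)] {f : ι → (LaurentPolynomial A)⟦X⟧}
    {g : (LaurentPolynomial A)⟦X⟧} (h : HasSum f g) :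
    HasSum (fun t => constTermX (f t)) (constTermX g) := by
  rw [WithPiTopology.hasSum_iff_hasSum_coeff] at h ⊢
  intro d
  have := (h d).map (constCoeff A) continuous_of_discreteTopology
  simp only [constTermX, coeff_mk]
  exact this

theorem constTermX_monomial (m : ℕ) (c : A) (j : ℤ) :
    constTermX (monomial m (LaurentPolynomial.C c * T j)) =
      if j = 0 then monomial m c else 0 := by
  ext d
  rw [constTermX, coeff_mk, coeff_monomial]
  by_cases hj : j = 0 <;> by_cases hd : d = m <;>
    simp [hj, hd, coeff_monomial, ← LaurentPolynomial.single_eq_C_mul_T]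

theorem prod_map_C_mul_T {γ : Type*} (w : γ → A) (j : ℤ) (l : List (ℕ × γ)) :
    (l.map fun p => LaurentPolynomial.C (w p.2) * T j).prod =
      LaurentPolynomial.C (l.map fun p => w p.2).prod * T (l.length * j) := by
  induction l with
  | nil => simp
  | cons p l ih =>
    rw [List.map_cons, List.prod_cons, ih, List.map_cons, List.prod_cons, map_mul,
      List.length_cons, Nat.cast_succ, add_mul, one_mul, add_comm, LaurentPolynomial.T_add]
    ring

theorem constTermX_listWt_mul {γ : Type*} (w w' : γ → A) (l l' : List (ℕ × γ)) :
    constTermX (X ^ l.length * listWt (fun i => LaurentPolynomial.C (w i) * T 1) l *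
      listWt (fun i => LaurentPolynomial.C (w' i) * T (-1)) l') =
    if l.length = l'.length then X ^ l.length * listWt w l * listWt w' l' else 0 := by
  rw [mul_assoc, mul_assoc, listWt_mul, listWt_mul, X_pow_eq, X_pow_eq, monomial_mul_monomial,
    monomial_mul_monomial, prod_map_C_mul_T, prod_map_C_mul_T, one_mul, one_mul]
  have : LaurentPolynomial.C (l.map fun p => w p.2).prod * T (l.length * 1) *
      (LaurentPolynomial.C (l'.map fun p => w' p.2).prod * T (l'.length * (-1))) =
      LaurentPolynomial.C ((l.map fun p => w p.2).prod * (l'.map fun p => w' p.2).prod) *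
        T ((l.length : ℤ) - l'.length) := by
    rw [map_mul, sub_eq_add_neg, LaurentPolynomial.T_add, mul_one, mul_neg_one]
    ring
  rw [this, constTermX_monomial]
  simp only [sub_eq_zero, Nat.cast_inj]

theorem constTermX_prod_qPochhammerInf [TopologicalSpace A] [DiscreteTopology A] {n : ℕ}
    (w w' : Fin n → A) :
    constTermX (∏ i : Fin n,
      qPochhammerInf (-(C (LaurentPolynomial.C (w i) * T 1) * X)) *
        qPochhammerInf (-(C (LaurentPolynomial.C (w' i) * T (-1))))) = frobeniusGf w w' := by
  let _ : TopologicalSpace (LaurentPolynomial A) := ⊥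
  have : DiscreteTopology (LaurentPolynomial A) := ⟨rfl⟩
  set v : Fin n → LaurentPolynomial A := fun i => LaurentPolynomial.C (w i) * T 1 with hv
  set v' : Fin n → LaurentPolynomial A := fun i => LaurentPolynomial.C (w' i) * T (-1) with hv'
  have hA : HasSum (fun l : rowsA n => X ^ l.1.length * listWt v l.1)
      (∏ i, qPochhammerInf (-(C (v i) * X))) := by
    have e := listGf_rowSet_eq_prod v 1
    simp only [pow_one] at e
    -- The factor q starts the product at K = 1, giving rows without zero parts; these are the
    -- shifts of all rows, and the shift supplies X ^ length.
    rw [← e, ← zero_add 1, ← rowSet_zero, ← shiftRow_image_rowSet]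
    have h := ((sizeFinite_rowSet n 0 0).summable v).hasSum
    rw [← shiftRow_image_rowSet] at h
    have h' := (Equiv.Set.image shiftRow (rowSet n 0 n) shiftRow_injective).hasSum_iff.2 h
    rw [← reverse_image_rowSet, ← (Equiv.Set.image List.reverse (rowSet n 0 n)
      List.reverse_injective).hasSum_iff]
    refine hasSum_of_eq h' fun l => ?_
    simp [listWt_shiftRow, listWt_reverse]
  have hB : HasSum (fun l : rowsB n => listWt v' l.1) (∏ i, qPochhammerInf (-(C (v' i)))) := by
    have e := listGf_rowSet_eq_prod (fun i : Fin n => v' i.rev) 0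
    simp only [pow_zero, mul_one] at e
    rw [← Equiv.prod_comp Fin.revPerm fun i => qPochhammerInf (-(C (v' i)))]
    simp only [Fin.revPerm_apply]
    rw [← e, ← listGf_reverse, reverse_image_rowSet, ← listGf_revColour, revColour_image_rowsA]
    exact ((sizeFinite_rowsB n).summable v').hasSum
  rw [Finset.prod_mul_distrib]
  have h := hasSum_constTermX (hA.mul hB (summable_mul (sizeFinite_rowsA n) (sizeFinite_rowsB n)
    v v' fun l => l.length))
  simp only [hv, hv', constTermX_listWt_mul] at h
  rw [← h.tsum_eq]
  -- Taking constant terms leaves only pairs of rows of equal length, which form the range of g.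
  let g : {r : List (ℕ × Fin n) × List (ℕ × Fin n) | IsFrobenius r} → rowsA n × rowsB n :=
    fun x => (⟨x.1.1, x.2.2.1⟩, ⟨x.1.2, x.2.2.2⟩)
  have hg : Function.Injective g := fun x y hxy => by
    have h1 := congrArg (fun z => z.1.1) hxy
    have h2 := congrArg (fun z => z.2.1) hxy
    exact Subtype.ext (Prod.ext h1 h2)
  rw [← hg.tsum_eq]
  · refine tsum_congr fun x => ?_
    exact if_pos x.2.1
  · intro x hx
    rw [Function.mem_support] at hx
    have : (x.1 : List (ℕ × Fin n)).length = (x.2 : List (ℕ × Fin n)).length := by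
      by_contra hne
      exact hx (if_neg hne)
    exact ⟨⟨(x.1.1, x.2.1), this, x.1.2, x.2.2⟩, rfl⟩

end ConstantTerm

/-! ### From counts to generating functions -/

section GeneratingFunctions

open PowerSeries
open scoped PowerSeries.WithPiTopology

theorem coeff_tsum_monomial {A ι : Type*} [CommRing A] [TopologicalSpace A] [DiscreteTopology A]
    {S : Set ι} (sz : ι → ℕ) (W : ι → A) (hfin : ∀ m, {t ∈ S | sz t = m}.Finite) (m : ℕ) :
    coeff m (∑' t : S, monomial (sz t) (W t)) = ∑ t ∈ (hfin m).toFinset, W t := by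
  have hs : Summable fun t : S => monomial (sz t) (W t) :=
    summable_of_finite_coeff fun m => ((hfin m).preimage Subtype.val_injective.injOn).subset
      fun t ht => ⟨t.2, by
        by_contra hne
        exact ht (by rw [coeff_monomial, if_neg (Ne.symm hne)])⟩
  rw [← ((WithPiTopology.hasSum_iff_hasSum_coeff A).1 hs.hasSum m).tsum_eq,
    tsum_subtype S (fun t => coeff m (monomial (sz t) (W t))),
    tsum_eq_sum (s := (hfin m).toFinset)]
  · refine Finset.sum_congr rfl fun t ht => ?_
    have ht := (hfin m).mem_toFinset.1 ht
    rw [Set.indicator_of_mem ht.1, ← ht.2, coeff_monomial_same]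
  · intro t ht
    rw [(hfin m).mem_toFinset] at ht
    by_cases hS : t ∈ S
    · rw [Set.indicator_of_mem hS, coeff_monomial, if_neg fun h => ht ⟨hS, h.symm⟩]
    · rw [Set.indicator_of_notMem hS]

/-- The objects of size m are grouped by their colour counts (u, v), and N m u v is the cardinality
of the fibre. -/
theorem genFun_eq_tsum {n : ℕ} [TopologicalSpace (ColourRing n)] [DiscreteTopology (ColourRing n)]
    {ι : Type*} {S : Set ι} (sz : ι → ℕ) (u v : ι → Fin n → ℕ)
    (hfin : ∀ m, {t ∈ S | sz t = m}.Finite) {N : ℕ → (Fin n → ℕ) → (Fin n → ℕ) → ℕ}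
    (hN : ∀ m e f, N m e f =
      {t ∈ {t ∈ S | sz t = m} | ∀ i, u t i = e i ∧ v t i = f i}.ncard) :
    genFun N = ∑' t : S, monomial (sz t) (aMonomial fun i => (u t i : ℤ) - (v t i : ℤ)) := by
  classical
  ext1 m
  rw [coeff_tsum_monomial sz (fun t => aMonomial fun i => (u t i : ℤ) - (v t i : ℤ)) hfin, genFun, coeff_mk]
  have hN' : ∀ ef : (Fin n → ℕ) × (Fin n → ℕ), N m ef.1 ef.2 =
      ((hfin m).toFinset.filter fun t => (u t, v t) = ef).card := by
    intro ef
    rw [hN, ← Set.ncard_coe_finset]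
    congr 1
    ext t
    simp [Prod.ext_iff, funext_iff, forall_and]
  rw [Finset.sum_comp (fun ef : (Fin n → ℕ) × (Fin n → ℕ) =>
    aMonomial fun i => (ef.1 i : ℤ) - (ef.2 i : ℤ)) fun t => (u t, v t)]
  rw [finsum_eq_sum_of_support_subset (s := (hfin m).toFinset.image fun t => (u t, v t))]
  · exact Finset.sum_congr rfl fun ef _ => by rw [hN']
  · intro ef hef
    by_contra hne
    refine hef ?_
    simp only
    rw [hN', Finset.card_eq_zero.2, zero_smul]
    refine Finset.filter_eq_empty_iff.2 fun t ht h => hne ?_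
    exact Finset.mem_coe.2 (Finset.mem_image.2 ⟨t, ht, h⟩)

theorem aMonomial_add {n : ℕ} (e f : Fin n → ℤ) :
    aMonomial (e + f) = aMonomial e * aMonomial f := by
  rw [aMonomial, aMonomial, aMonomial, AddMonoidAlgebra.single_mul_single, one_mul]

theorem aMonomial_zero {n : ℕ} : aMonomial (0 : Fin n → ℤ) = 1 := rfl

/-- The Laurent monomial `a_j ^ e`, which is `1` if `n ≤ j`. -/
noncomputable def aPow (n : ℕ) (e : ℤ) (j : ℕ) : ColourRing n :=
  aMonomial fun i => if (i : ℕ) = j then e else 0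

theorem aPow_mul_aPow_neg (n : ℕ) (j : ℕ) : aPow n 1 j * aPow n (-1) j = 1 := by
  rw [aPow, aPow, ← aMonomial_add, ← aMonomial_zero]
  congr 1
  funext i
  simp only [Pi.add_apply, Pi.zero_apply]
  split_ifs <;> rfl

theorem aPow_eq (n : ℕ) (e : ℤ) (i : Fin n) : aPow n e i = aMonomial (Pi.single i e) := by
  rw [aPow]
  congr 1
  funext j
  simp only [Pi.single_apply, Fin.ext_iff]

theorem prod_aPow {n : ℕ} {γ : Type*} (e : ℤ) (f : γ → Fin n) (l : List (ℕ × γ)) :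
    (l.map fun p => aPow n e (f p.2)).prod =
      aMonomial fun i => (l.countP fun p => f p.2 = i) * e := by
  induction l with
  | nil => simp [← aMonomial_zero, Pi.zero_def]
  | cons p l ih =>
    rw [List.map_cons, List.prod_cons, ih, aPow, ← aMonomial_add]
    congr 1
    funext i
    simp only [Pi.add_apply, List.countP_cons, decide_eq_true_eq, Fin.ext_iff, Nat.cast_add,
      Nat.cast_ite, Nat.cast_one, Nat.cast_zero, eq_comm (a := (i : ℕ))]
    split_ifs <;> ring

theorem prod_colourWt_aPow {n : ℕ} (l : List (ℕ × Colour n)) :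
    (l.map fun p => colourWt (aPow n 1) (aPow n (-1)) p.2).prod =
      aMonomial fun i => ((l.countP fun p => p.2.1 = i : ℕ) : ℤ) -
        ((l.countP fun p => p.2.2 = i : ℕ) : ℤ) := by
  simp only [colourWt]
  rw [List.prod_map_mul, prod_aPow 1 Prod.fst, prod_aPow (-1) Prod.snd, ← aMonomial_add]
  congr 1
  funext i
  simp only [Pi.add_apply]
  ring

theorem sizeFinite_isPrimc (n : ℕ) : SizeFinite {l : List (ℕ × Colour n) | IsPrimc l} :=
  sizeFinite_pos.mono fun _ h => h.1

variable {n : ℕ} [TopologicalSpace (ColourRing n)] [DiscreteTopology (ColourRing n)]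

theorem genFun_primcCount : genFun (primcCount n) =
    listGf (colourWt (aPow n 1) (aPow n (-1))) {l : List (ℕ × Colour n) | IsPrimc l} := by
  rw [genFun_eq_tsum (N := primcCount n) size (fun l i => l.countP fun p => p.2.1 = i)
    (fun l i => l.countP fun p => p.2.2 = i) (sizeFinite_isPrimc n) (fun m e f => rfl)]
  refine tsum_congr fun l => ?_
  rw [listWt, prod_colourWt_aPow]

theorem genFun_frobeniusCount : genFun (frobeniusCount n) =
    frobeniusGf (fun i : Fin n => aPow n 1 i) (fun i : Fin n => aPow n (-1) i) := by
  rw [genFun_eq_tsum (N := frobeniusCount n)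
    (S := {r : List (ℕ × Fin n) × List (ℕ × Fin n) | IsFrobenius r})
    (fun r => r.1.length + size r.1 + size r.2) (fun r i => r.1.countP fun p => p.2 = i)
    (fun r i => r.2.countP fun p => p.2 = i) (finite_frobeniusPartitions n) (fun m e f => rfl)]
  refine tsum_congr fun x => ?_
  have e1 := prod_aPow (n := n) 1 id x.1.1
  have e2 := prod_aPow (n := n) (-1) id x.1.2
  simp only [id_eq] at e1 e2
  rw [mul_assoc, listWt_mul, X_pow_eq, monomial_mul_monomial, one_mul, e1, e2, ← aMonomial_add,
    ← add_assoc]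
  congr 2
  funext i
  simp only [Pi.add_apply]
  ring

end GeneratingFunctions

end PrimcFrobenius

theorem mainTheorem2 (n : ℕ) (hn : 0 < n) :
    (∀ m : ℕ, (PrimcFrobenius.primcPartitions n m).Finite) ∧
    (∀ m : ℕ, (PrimcFrobenius.frobeniusPartitions n m).Finite) ∧
    PrimcFrobenius.genFun (PrimcFrobenius.primcCount n) =
      PrimcFrobenius.genFun (PrimcFrobenius.frobeniusCount n) ∧
    PrimcFrobenius.genFun (PrimcFrobenius.frobeniusCount n) =
      PrimcFrobenius.constTermX (PrimcFrobenius.frobeniusProduct n) := by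
  let _ : TopologicalSpace (PrimcFrobenius.ColourRing n) := ⊥
  have : DiscreteTopology (PrimcFrobenius.ColourRing n) := ⟨rfl⟩
  refine ⟨PrimcFrobenius.sizeFinite_isPrimc n, PrimcFrobenius.finite_frobeniusPartitions n, ?_, ?_⟩
  · rw [PrimcFrobenius.genFun_primcCount, PrimcFrobenius.genFun_frobeniusCount,
      PrimcFrobenius.frobeniusGf_eq_tsum, PrimcFrobenius.listGf_isPrimc n
        (fun i _ => PrimcFrobenius.aPow_mul_aPow_neg n i) (PrimcFrobenius.isRowPair n _ _)]
    -- The bound n - 0 in V r 0 reduces to n.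
    rfl
  · rw [PrimcFrobenius.genFun_frobeniusCount,
      ← PrimcFrobenius.constTermX_prod_qPochhammerInf, PrimcFrobenius.frobeniusProduct]
    simp only [PrimcFrobenius.xaMonomial, PrimcFrobenius.aPow_eq, Pi.single_neg]
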